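/- Let $K$ be a field of characteristic zero (e.g. $K=\mathbb{C}$). Let $\mathcal{H}$ be the Hopf algebra over $K$ which, as an algebra, is the enveloping algebra of the Lie algebra with basis $Y$, $X$, $\delta_m$ ($m\ge 1$) and brackets $[Y,X]=X$, $[Y,\delta_m]=m\,\delta_m$, $[X,\delta_m]=\delta_{m+1}$, $[\delta_m,\delta_p]=0$, and whose coproduct is the algebra homomorphism determined by $\Delta Y=Y\otimes 1+1\otimes Y$, $\Delta X=X\otimes 1+1\otimes X+\delta_1\otimes Y$, $\Delta\delta_1=\delta_1\otimes 1+1\otimes\delta_1$. For $n\ge 0$ let $\mathcal{H}_n\subset\mathcal{H}$ be the Hopf subalgebra generated as an algebra by $\delta_1,\dots,\delta_n$. Let $\mathcal{A}_n^1$ be the Lie algebra of $(n+1)$-jets of vector fields vanishing to order $2$ at $0$, i.e. of formal vector fields $f(x)\,\partial/\partial x$ over $K$ with $f(0)=f'(0)=0$, modulo $x^{n+2}\,\partial/\partial x$; let $Z_k\in\mathcal{A}_n^1$ be the class of $\frac{x^{k+1}}{(k+1)!}\,\partial/\partial x$, $k\ge 1$. Let $\mathcal{U}(\mathcal{A}_n^1)$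 be the enveloping algebra with its standard Hopf algebra structure (elements of $\mathcal{A}_n^1$ are primitive). Then $\mathcal{H}_n$ is commutative and is the restricted dual Hopf algebra of $\mathcal{U}(\mathcal{A}_n^1)$. Precisely: the linear forms on $\mathcal{U}(\mathcal{A}_n^1)$ that vanish on some power of the augmentation ideal are the same as those that vanish on all products $Z_{k_1}\cdots Z_{k_r}$ of sufficiently large weight $k_1+\dots+k_r$, and there is a linear isomorphism $P\mapsto\langle P,\cdot\rangle$ from $\mathcal{H}_n$ onto the space of these linear forms under which all the Hopf algebra operations are transposed to each other: for all $P,Q\in\mathcal{H}_n$ and $a,b\in\mathcal{U}(\mathcal{A}_n^1)$, $$\langle PQ,a\rangle=\langle P\otimes Q,\Delta a\rangle,\quad \langle 1,a\rangle=\varepsilon(a),\quad \langle P,ab\rangle=\langle\Delta P,a\otimes b\rangle,\quad \langle P,1\rangle=\varepsilon(P),\quad \langle SP,a\rangle=\langle P,Sa\rangle,$$ and moreover $\langle\delta_j,Z_k\rangle=\delta_{jk}$ (Kronecker symbol) for $1\le j,k\le n$. -/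

import Mathlib

open scoped TensorProduct PowerSeries

noncomputable section

attribute [local instance 100] LieRing.ofAssociativeRing

/-! ## The enveloping algebra of a Lie algebra as a Hopf algebra -/

namespace HopfAux

variable {K : Type*} [CommRing K] {A : Type*} [Ring A]

/-- An anti-endomorphism, seen as a linear endomorphism. -/
def unopLin [Algebra K A] (S : A →ₐ[K] Aᵐᵒᵖ) : A →ₗ[K] A :=
  (MulOpposite.opLinearEquiv K).symm.toLinearMap ∘ₗ S.toLinearMap

theorem unopLin_apply [Algebra K A] (S : A →ₐ[K] Aᵐᵒᵖ) (a : A) :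
    unopLin S a = (S a).unop := rfl

variable [Bialgebra K A]

theorem left_aux (S : A →ₐ[K] Aᵐᵒᵖ) (t u : A ⊗[K] A) (c : K)
    (ht : LinearMap.mul' K A ((unopLin S).rTensor A t) = algebraMap K A c) :
    LinearMap.mul' K A ((unopLin S).rTensor A (t * u)) =
      algebraMap K A c * LinearMap.mul' K A ((unopLin S).rTensor A u) := by
  induction u using TensorProduct.induction_on with
  | zero => simp
  | add u v hu hv => simp only [mul_add, map_add, hu, hv]
  | tmul b b' =>
    have key : ∀ w : A ⊗[K] A,
        LinearMap.mul' K A ((unopLin S).rTensor A (w * b ⊗ₜ b')) =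
          unopLin S b * LinearMap.mul' K A ((unopLin S).rTensor A w) * b' := by
      intro w
      induction w using TensorProduct.induction_on with
      | zero => simp
      | add u v hu hv => simp only [add_mul, mul_add, map_add, hu, hv]
      | tmul p q => simp [unopLin_apply, mul_assoc]
    rw [key, ht, ← Algebra.commutes c (unopLin S b)]
    simp [mul_assoc]

theorem right_aux (S : A →ₐ[K] Aᵐᵒᵖ) (t u : A ⊗[K] A) (c : K)
    (hu : LinearMap.mul' K A ((unopLin S).lTensor A u) = algebraMap K A c) :
    LinearMap.mul' K A ((unopLin S).lTensor A (t * u)) =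
      LinearMap.mul' K A ((unopLin S).lTensor A t) * algebraMap K A c := by
  induction t using TensorProduct.induction_on with
  | zero => simp
  | add u v hu hv => simp only [add_mul, map_add, hu, hv]
  | tmul b b' =>
    have key : ∀ w : A ⊗[K] A,
        LinearMap.mul' K A ((unopLin S).lTensor A (b ⊗ₜ b' * w)) =
          b * LinearMap.mul' K A ((unopLin S).lTensor A w) * unopLin S b' := by
      intro w
      induction w using TensorProduct.induction_on with
      | zero => simp
      | add u v hu hv => simp only [add_mul, mul_add, map_add, hu, hv]
      | tmul p q => simp [unopLin_apply, mul_assoc]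
    rw [key, hu, mul_assoc, Algebra.commutes c (unopLin S b')]
    simp [mul_assoc]

/-- The antipode identities for an anti-homomorphism need only be checked on generators. -/
abbrev hopfOfGenerators (S : A →ₐ[K] Aᵐᵒᵖ) (s : Set A) (hs : Algebra.adjoin K s = ⊤)
    (hl : ∀ a ∈ s, LinearMap.mul' K A ((unopLin S).rTensor A (Coalgebra.comul a)) =
      algebraMap K A (Coalgebra.counit a))
    (hr : ∀ a ∈ s, LinearMap.mul' K A ((unopLin S).lTensor A (Coalgebra.comul a)) =
      algebraMap K A (Coalgebra.counit a)) :
    HopfAlgebra K A where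
  antipode := unopLin S
  mul_antipode_rTensor_comul := by
    ext a
    have ha : a ∈ Algebra.adjoin K s := hs ▸ Algebra.mem_top
    simp only [LinearMap.comp_apply, Algebra.linearMap_apply]
    induction ha using Algebra.adjoin_induction with
    | mem a ha => exact hl a ha
    | algebraMap r =>
      simp [Algebra.TensorProduct.algebraMap_apply, unopLin_apply]
    | add a b _ _ ha hb => simp only [map_add, ha, hb]
    | mul a b _ _ ha hb =>
      rw [Bialgebra.comul_mul, left_aux S _ _ _ ha, hb, Bialgebra.counit_mul, map_mul]
  mul_antipode_lTensor_comul := by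
    ext a
    have ha : a ∈ Algebra.adjoin K s := hs ▸ Algebra.mem_top
    simp only [LinearMap.comp_apply, Algebra.linearMap_apply]
    induction ha using Algebra.adjoin_induction with
    | mem a ha => exact hr a ha
    | algebraMap r =>
      simp [Algebra.TensorProduct.algebraMap_apply, unopLin_apply]
    | add a b _ _ ha hb => simp only [map_add, ha, hb]
    | mul a b _ _ ha hb =>
      rw [Bialgebra.comul_mul, right_aux S _ _ _ hb, ha, Bialgebra.counit_mul, map_mul]

section Sub

variable {F : Type*} [Field F] {H : Type*} [Ring H] [HopfAlgebra F H] (B : Subalgebra F H)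

/-- The inclusion `B ⊗ B → H ⊗ H`. -/
def incl₂ : B ⊗[F] B →ₐ[F] H ⊗[F] H := Algebra.TensorProduct.map B.val B.val

theorem incl₂_injective : Function.Injective (incl₂ B) :=
  TensorProduct.map_injective_of_flat_flat B.val.toLinearMap B.val.toLinearMap
    Subtype.val_injective Subtype.val_injective

variable (hΔ : ∀ b ∈ B, Coalgebra.comul (R := F) b ∈ (incl₂ B).range)
  (hS : ∀ b ∈ B, HopfAlgebra.antipode F b ∈ B)

/-- The coproduct of `H` restricted to a subalgebra `B` with `Δ(B) ⊆ B ⊗ B`. -/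
def subComul : B →ₐ[F] B ⊗[F] B :=
  (AlgEquiv.ofInjective (incl₂ B) (incl₂_injective B)).symm.toAlgHom.comp
    (((Bialgebra.comulAlgHom F H).comp B.val).codRestrict (incl₂ B).range
      fun b => hΔ b b.2)

theorem incl₂_subComul (b : B) : incl₂ B (subComul B hΔ b) = Coalgebra.comul (R := F) (b : H) := by
  have h := AlgEquiv.apply_symm_apply (AlgEquiv.ofInjective (incl₂ B) (incl₂_injective B))
    (((Bialgebra.comulAlgHom F H).comp B.val).codRestrict (incl₂ B).range
      (fun b => hΔ b b.2) b)
  exact congrArg Subtype.val h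

/-- A subalgebra stable under the coproduct is a bialgebra. -/
abbrev subBialgebra : Bialgebra F B :=
  Bialgebra.ofAlgHom (subComul B hΔ) ((Bialgebra.counitAlgHom F H).comp B.val)
    (by
      ext b
      have hinj : Function.Injective (Algebra.TensorProduct.map B.val (incl₂ B)) :=
        TensorProduct.map_injective_of_flat_flat B.val.toLinearMap (incl₂ B).toLinearMap
          Subtype.val_injective (incl₂_injective B)
      apply hinj
      have h1 : ∀ t : B ⊗[F] B, Algebra.TensorProduct.map B.val (incl₂ B)
          (Algebra.TensorProduct.assoc F F F B B B
            (Algebra.TensorProduct.map (subComul B hΔ) (.id F B) t)) =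
          Algebra.TensorProduct.assoc F F F H H H
            (Algebra.TensorProduct.map (Bialgebra.comulAlgHom F H) (.id F H) (incl₂ B t)) := by
        intro t
        induction t using TensorProduct.induction_on with
        | zero => simp
        | add u v hu hv => simp only [map_add, hu, hv]
        | tmul p q =>
          have h2 : ∀ u : B ⊗[F] B, Algebra.TensorProduct.map B.val (incl₂ B)
              (Algebra.TensorProduct.assoc F F F B B B (u ⊗ₜ q)) =
              Algebra.TensorProduct.assoc F F F H H H (incl₂ B u ⊗ₜ (q : H)) := by
            intro u
            induction u using TensorProduct.induction_on with
            | zero => simp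
            | add u v hu hv => simp only [map_add, TensorProduct.add_tmul, hu, hv]
            | tmul _ _ => rfl
          have := h2 (subComul B hΔ p)
          rw [incl₂_subComul] at this
          exact this
      have h3 : ∀ t : B ⊗[F] B, Algebra.TensorProduct.map B.val (incl₂ B)
            (Algebra.TensorProduct.map (.id F B) (subComul B hΔ) t) =
            Algebra.TensorProduct.map (.id F H) (Bialgebra.comulAlgHom F H) (incl₂ B t) := by
        intro t
        induction t using TensorProduct.induction_on with
        | zero => simp
        | add u v hu hv => simp only [map_add, hu, hv]
        | tmul p q =>
          simp only [incl₂, Algebra.TensorProduct.map_tmul]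
          have := incl₂_subComul B hΔ q
          simp only [incl₂] at this
          rw [this]; rfl
      have h4 := h1 (subComul B hΔ b)
      have h5 := h3 (subComul B hΔ b)
      rw [incl₂_subComul] at h4 h5
      refine h4.trans (Eq.trans ?_ h5.symm)
      exact Coalgebra.coassoc_apply (R := F) (b : H))
    (by
      ext b
      apply (Algebra.TensorProduct.lid F B).injective
      apply Subtype.val_injective
      have h1 : ∀ t : B ⊗[F] B, ((Algebra.TensorProduct.lid F B
          (Algebra.TensorProduct.map ((Bialgebra.counitAlgHom F H).comp B.val) (.id F B) t) : B)
            : H) = Algebra.TensorProduct.lid F H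
          (Algebra.TensorProduct.map (Bialgebra.counitAlgHom F H) (.id F H) (incl₂ B t)) := by
        intro t
        induction t using TensorProduct.induction_on with
        | zero => simp
        | add u v hu hv => simp only [map_add, Subalgebra.coe_add, hu, hv]
        | tmul p q => simp [incl₂]
      have h2 := h1 (subComul B hΔ b)
      rw [incl₂_subComul] at h2
      refine h2.trans ?_
      have h3 := Coalgebra.rTensor_counit_comul (R := F) (b : H)
      have h4 : Algebra.TensorProduct.map (Bialgebra.counitAlgHom F H) (.id F H)
          (Coalgebra.comul (R := F) (b : H)) = 1 ⊗ₜ (b : H) := h3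
      rw [h4]; simp)
    (by
      ext b
      apply (Algebra.TensorProduct.rid F F B).injective
      apply Subtype.val_injective
      have h1 : ∀ t : B ⊗[F] B, ((Algebra.TensorProduct.rid F F B
          (Algebra.TensorProduct.map (.id F B) ((Bialgebra.counitAlgHom F H).comp B.val) t) : B)
            : H) = Algebra.TensorProduct.rid F F H
          (Algebra.TensorProduct.map (.id F H) (Bialgebra.counitAlgHom F H) (incl₂ B t)) := by
        intro t
        induction t using TensorProduct.induction_on with
        | zero => simp
        | add u v hu hv => simp only [map_add, Subalgebra.coe_add, hu, hv]
        | tmul p q => simp [incl₂]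
      have h2 := h1 (subComul B hΔ b)
      rw [incl₂_subComul] at h2
      refine h2.trans ?_
      have h3 := Coalgebra.lTensor_counit_comul (R := F) (b : H)
      have h4 : Algebra.TensorProduct.map (.id F H) (Bialgebra.counitAlgHom F H)
          (Coalgebra.comul (R := F) (b : H)) = (b : H) ⊗ₜ 1 := h3
      rw [h4]; simp)

/-- A subalgebra stable under the coproduct and the antipode is a Hopf algebra, with the
restricted operations. -/
abbrev subHopf : HopfAlgebra F B :=
  { subBialgebra B hΔ with
    antipode := ((HopfAlgebra.antipode F).comp B.val.toLinearMap).codRestrict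
      (Subalgebra.toSubmodule B) fun b => hS b b.2
    mul_antipode_rTensor_comul := by
      ext b
      have h1 : ∀ t : B ⊗[F] B, ((LinearMap.mul' F B (LinearMap.rTensor B
          (((HopfAlgebra.antipode F).comp B.val.toLinearMap).codRestrict
            (Subalgebra.toSubmodule B) fun b => hS b b.2) t) : B) : H) =
          LinearMap.mul' F H ((HopfAlgebra.antipode F).rTensor H (incl₂ B t)) := by
        intro t
        induction t using TensorProduct.induction_on with
        | zero => simp
        | add u v hu hv => simp only [map_add, Subalgebra.coe_add, hu, hv]
        | tmul p q => rfl
      refine (h1 (subComul B hΔ b)).trans ?_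
      rw [incl₂_subComul, HopfAlgebra.mul_antipode_rTensor_comul_apply]
      rfl
    mul_antipode_lTensor_comul := by
      ext b
      have h1 : ∀ t : B ⊗[F] B, ((LinearMap.mul' F B (LinearMap.lTensor B
          (((HopfAlgebra.antipode F).comp B.val.toLinearMap).codRestrict
            (Subalgebra.toSubmodule B) fun b => hS b b.2) t) : B) : H) =
          LinearMap.mul' F H ((HopfAlgebra.antipode F).lTensor H (incl₂ B t)) := by
        intro t
        induction t using TensorProduct.induction_on with
        | zero => simp
        | add u v hu hv => simp only [map_add, Subalgebra.coe_add, hu, hv]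
        | tmul p q => rfl
      refine (h1 (subComul B hΔ b)).trans ?_
      rw [incl₂_subComul, HopfAlgebra.mul_antipode_lTensor_comul_apply]
      rfl }

end Sub

end HopfAux

namespace UEA

variable (K : Type*) [CommRing K] (L : Type*) [LieRing L] [LieAlgebra K L]

theorem adjoin_range_ι :
    Algebra.adjoin K (Set.range (UniversalEnvelopingAlgebra.ι K (L := L))) = ⊤ := by
  set B := Algebra.adjoin K (Set.range (UniversalEnvelopingAlgebra.ι K (L := L)))
  let f : L →ₗ⁅K⁆ B :=
    { toFun := fun x => ⟨UniversalEnvelopingAlgebra.ι K x, Algebra.subset_adjoin ⟨x, rfl⟩⟩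
      map_add' := fun x y => Subtype.ext (by simp)
      map_smul' := fun c x => Subtype.ext (by simp)
      map_lie' := fun {x y} => Subtype.ext (by
        simp [LieRing.of_associative_ring_bracket]) }
  have h : B.val.comp (UniversalEnvelopingAlgebra.lift K f) = AlgHom.id K _ := by
    apply UniversalEnvelopingAlgebra.hom_ext
    ext x
    simp only [LieHom.comp_apply, AlgHom.coe_toLieHom, AlgHom.comp_apply,
      UniversalEnvelopingAlgebra.lift_ι_apply]
    rfl
  rw [eq_top_iff]
  intro a _
  have := DFunLike.congr_fun h a
  simp only [AlgHom.comp_apply, AlgHom.id_apply] at this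
  rw [← this]
  exact (UniversalEnvelopingAlgebra.lift K f a).2

/-- The coproduct of `U(L)`: elements of `L` are primitive. -/
def comulHom : UniversalEnvelopingAlgebra K L →ₐ[K]
    UniversalEnvelopingAlgebra K L ⊗[K] UniversalEnvelopingAlgebra K L :=
  UniversalEnvelopingAlgebra.lift K
    { toFun := fun x => UniversalEnvelopingAlgebra.ι K x ⊗ₜ 1 +
        1 ⊗ₜ UniversalEnvelopingAlgebra.ι K x
      map_add' := fun x y => by
        simp only [map_add, TensorProduct.add_tmul, TensorProduct.tmul_add]; abel
      map_smul' := fun c x => by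
        simp [TensorProduct.smul_tmul']
      map_lie' := fun {x y} => by
        simp only [LieHom.map_lie, LieRing.of_associative_ring_bracket, mul_add, add_mul,
          Algebra.TensorProduct.tmul_mul_tmul, one_mul, mul_one, TensorProduct.sub_tmul,
          TensorProduct.tmul_sub]
        abel }

/-- The counit of `U(L)`, killing `L`. -/
def counitHom : UniversalEnvelopingAlgebra K L →ₐ[K] K :=
  UniversalEnvelopingAlgebra.lift K (0 : L →ₗ⁅K⁆ K)

/-- The antipode of `U(L)` as an anti-homomorphism: `x ↦ -x` on `L`. -/
def antipodeHom : UniversalEnvelopingAlgebra K L →ₐ[K] (UniversalEnvelopingAlgebra K L)ᵐᵒᵖ :=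
  UniversalEnvelopingAlgebra.lift K
    { toFun := fun x => MulOpposite.op (-UniversalEnvelopingAlgebra.ι K x)
      map_add' := fun x y => by
        rw [← MulOpposite.op_add, map_add, neg_add]
      map_smul' := fun c x => by
        rw [map_smul, ← smul_neg, MulOpposite.op_smul]; rfl
      map_lie' := fun {x y} => by
        simp only [LieHom.map_lie, LieRing.of_associative_ring_bracket, ← MulOpposite.op_mul,
          ← MulOpposite.op_sub]
        congr 1
        simp }

theorem comulHom_ι (x : L) : comulHom K L (UniversalEnvelopingAlgebra.ι K x) =
    UniversalEnvelopingAlgebra.ι K x ⊗ₜ 1 + 1 ⊗ₜ UniversalEnvelopingAlgebra.ι K x := by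
  rw [comulHom, UniversalEnvelopingAlgebra.lift_ι_apply]; rfl

theorem counitHom_ι (x : L) : counitHom K L (UniversalEnvelopingAlgebra.ι K x) = 0 := by
  rw [counitHom, UniversalEnvelopingAlgebra.lift_ι_apply]; rfl

theorem antipodeHom_ι (x : L) : antipodeHom K L (UniversalEnvelopingAlgebra.ι K x) =
    MulOpposite.op (-UniversalEnvelopingAlgebra.ι K x) := by
  rw [antipodeHom, UniversalEnvelopingAlgebra.lift_ι_apply]; rfl

instance instBialgebra : Bialgebra K (UniversalEnvelopingAlgebra K L) :=
  Bialgebra.ofAlgHom (comulHom K L) (counitHom K L)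
    (by
      apply AlgHom.ext_of_adjoin_eq_top (adjoin_range_ι K L)
      rintro _ ⟨x, rfl⟩
      simp [comulHom_ι, -UniversalEnvelopingAlgebra.ι_apply, Algebra.TensorProduct.one_def,
        TensorProduct.add_tmul, TensorProduct.tmul_add]
      abel)
    (by
      apply AlgHom.ext_of_adjoin_eq_top (adjoin_range_ι K L)
      rintro _ ⟨x, rfl⟩
      simp [comulHom_ι, counitHom_ι, -UniversalEnvelopingAlgebra.ι_apply])
    (by
      apply AlgHom.ext_of_adjoin_eq_top (adjoin_range_ι K L)
      rintro _ ⟨x, rfl⟩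
      simp [comulHom_ι, counitHom_ι, -UniversalEnvelopingAlgebra.ι_apply])

theorem comul_ι (x : L) : Coalgebra.comul (R := K) (UniversalEnvelopingAlgebra.ι K x) =
    UniversalEnvelopingAlgebra.ι K x ⊗ₜ[K] 1 + 1 ⊗ₜ UniversalEnvelopingAlgebra.ι K x :=
  comulHom_ι K L x

theorem counit_ι (x : L) :
    Coalgebra.counit (R := K) (UniversalEnvelopingAlgebra.ι K x) = 0 :=
  counitHom_ι K L x

/-- The standard Hopf algebra structure of an enveloping algebra. -/
instance instHopfAlgebra : HopfAlgebra K (UniversalEnvelopingAlgebra K L) :=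
  HopfAux.hopfOfGenerators (antipodeHom K L) _ (adjoin_range_ι K L)
    (by
      rintro _ ⟨x, rfl⟩
      rw [comul_ι, counit_ι]
      simp [HopfAux.unopLin_apply, antipodeHom_ι, -UniversalEnvelopingAlgebra.ι_apply])
    (by
      rintro _ ⟨x, rfl⟩
      rw [comul_ι, counit_ι]
      simp [HopfAux.unopLin_apply, antipodeHom_ι, -UniversalEnvelopingAlgebra.ι_apply])

end UEA


/-! ## The Lie algebra spanned by `Y`, `X`, `δ_n`, `n ≥ 1` -/

namespace ConnesMoscovici

/-- The vector space with basis `Y`, `X`, `δ_n`, `n ≥ 1`; the element `(y, x, d)` stands for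
`y Y + x X + ∑ n, d n • δ_n`. -/
@[ext]
structure LieH (K : Type*) [Field K] where
  /-- the coefficient of `Y` -/
  y : K
  /-- the coefficient of `X` -/
  x : K
  /-- the coefficients of the `δ_n` -/
  d : ℕ+ →₀ K

variable (K : Type*) [Field K]

namespace LieH

/-- `LieH` as a product of vector spaces. -/
def equivProd : LieH K ≃ K × K × (ℕ+ →₀ K) where
  toFun a := (a.y, a.x, a.d)
  invFun p := ⟨p.1, p.2.1, p.2.2⟩
  left_inv _ := rfl
  right_inv _ := rfl

instance : AddCommGroup (LieH K) := (equivProd K).addCommGroup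
instance : Module K (LieH K) := (equivProd K).module K

variable {K}

@[simp] theorem add_y (a b : LieH K) : (a + b).y = a.y + b.y := rfl
@[simp] theorem add_x (a b : LieH K) : (a + b).x = a.x + b.x := rfl
@[simp] theorem add_d (a b : LieH K) : (a + b).d = a.d + b.d := rfl
@[simp] theorem zero_y : (0 : LieH K).y = 0 := rfl
@[simp] theorem zero_x : (0 : LieH K).x = 0 := rfl
@[simp] theorem zero_d : (0 : LieH K).d = 0 := rfl
@[simp] theorem smul_y (c : K) (a : LieH K) : (c • a).y = c * a.y := rfl
@[simp] theorem smul_x (c : K) (a : LieH K) : (c • a).x = c * a.x := rfl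
@[simp] theorem smul_d (c : K) (a : LieH K) : (c • a).d = c • a.d := rfl

variable (K)

/-- `δ_n ↦ n δ_n`, the action of `Y`. -/
def weight : (ℕ+ →₀ K) →ₗ[K] (ℕ+ →₀ K) :=
  Finsupp.linearCombination K fun n => Finsupp.single n ((n : ℕ) : K)

/-- `δ_n ↦ δ_{n+1}`, the action of `X`. -/
def shift : (ℕ+ →₀ K) →ₗ[K] (ℕ+ →₀ K) :=
  Finsupp.linearCombination K fun n => Finsupp.single (n + 1) (1 : K)

theorem weight_shift (v : ℕ+ →₀ K) :
    weight K (shift K v) = shift K (weight K v) + shift K v := by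
  have h : weight K ∘ₗ shift K = shift K ∘ₗ weight K + shift K := by
    apply Finsupp.lhom_ext'
    intro n
    ext1
    simp [weight, shift, ← Finsupp.single_add]
  exact LinearMap.congr_fun h v

/-- The bracket determined by `[Y, X] = X`, `[Y, δ_n] = n δ_n`, `[X, δ_n] = δ_{n+1}`,
`[δ_n, δ_m] = 0`. -/
instance : Bracket (LieH K) (LieH K) where
  bracket a b :=
    { y := 0
      x := a.y * b.x - b.y * a.x
      d := a.y • weight K b.d - b.y • weight K a.d + a.x • shift K b.d - b.x • shift K a.d }

variable {K}

@[simp] theorem lie_y (a b : LieH K) : ⁅a, b⁆.y = 0 := rfl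
@[simp] theorem lie_x (a b : LieH K) : ⁅a, b⁆.x = a.y * b.x - b.y * a.x := rfl
@[simp] theorem lie_d (a b : LieH K) : ⁅a, b⁆.d =
    a.y • weight K b.d - b.y • weight K a.d + a.x • shift K b.d - b.x • shift K a.d := rfl

instance : LieRing (LieH K) where
  add_lie a b c := by
    ext1
    · simp
    · simp; ring
    · simp only [lie_d, add_y, add_x, add_d, map_add]; module
  lie_add a b c := by
    ext1
    · simp
    · simp; ring
    · simp only [lie_d, add_y, add_x, add_d, map_add]; module
  lie_self a := by
    ext1
    · simp
    · simp
    · simp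
  leibniz_lie a b c := by
    ext1
    · simp
    · simp; ring
    · simp only [lie_d, lie_y, lie_x, add_d, map_add, map_sub, map_smul, weight_shift]; module

instance : LieAlgebra K (LieH K) where
  lie_smul c a b := by
    ext1
    · simp
    · simp; ring
    · simp only [lie_d, smul_y, smul_x, smul_d, map_smul]; module

variable (K)

/-- The basis vector `Y`. -/
def Y : LieH K := ⟨1, 0, 0⟩
/-- The basis vector `X`. -/
def X : LieH K := ⟨0, 1, 0⟩
/-- The basis vector `δ_n`. -/
def δ (n : ℕ+) : LieH K := ⟨0, 0, Finsupp.single n 1⟩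

theorem lie_Y_X : ⁅Y K, X K⁆ = X K := by ext1 <;> simp [X, Y]
theorem lie_Y_δ (n : ℕ+) : ⁅Y K, δ K n⁆ = ((n : ℕ) : K) • δ K n := by
  ext1 <;> simp [Y, δ, weight]
theorem lie_X_δ (n : ℕ+) : ⁅X K, δ K n⁆ = δ K (n + 1) := by
  ext1 <;> simp [X, δ, shift]
theorem lie_δ_δ (n m : ℕ+) : ⁅δ K n, δ K m⁆ = 0 := by
  ext1 <;> simp [δ]

/-- A Lie homomorphism from `LieH` to an associative algebra, from its values on `Y`, `X` and
the `δ_n`. -/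
def toAssoc {A : Type*} [Ring A] [Algebra K A] (y x : A) (d : ℕ+ → A)
    (hyx : y * x - x * y = x) (hyd : ∀ n, y * d n - d n * y = ((n : ℕ) : K) • d n)
    (hxd : ∀ n, x * d n - d n * x = d (n + 1)) (hdd : ∀ n m, d n * d m = d m * d n) :
    LieH K →ₗ⁅K⁆ A :=
  { toFun := fun a => a.y • y + a.x • x + Finsupp.linearCombination K d a.d
    map_add' := fun a b => by simp only [add_y, add_x, add_d, map_add]; module
    map_smul' := fun c a => by
      simp only [smul_y, smul_x, smul_d, map_smul, RingHom.id_apply]; module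
    map_lie' := fun {a b} => by
      have h1 : ∀ v, Finsupp.linearCombination K d (weight K v) =
          y * Finsupp.linearCombination K d v - Finsupp.linearCombination K d v * y := by
        intro v
        induction v using Finsupp.induction_linear with
        | zero => simp
        | add f g hf hg => simp only [map_add, hf, hg, mul_add, add_mul]; abel
        | single n c =>
          simp only [weight, Finsupp.linearCombination_single, map_smul,
            mul_smul_comm, smul_mul_assoc, ← smul_sub, hyd]
      have h2 : ∀ v, Finsupp.linearCombination K d (shift K v) =
          x * Finsupp.linearCombination K d v - Finsupp.linearCombination K d v * x := by
        intro v
        induction v using Finsupp.induction_linear with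
        | zero => simp
        | add f g hf hg => simp only [map_add, hf, hg, mul_add, add_mul]; abel
        | single n c =>
          simp only [shift, Finsupp.linearCombination_single, map_smul, one_smul,
            mul_smul_comm, smul_mul_assoc, ← smul_sub, hxd]
      have h3 : ∀ v w, Finsupp.linearCombination K d v * Finsupp.linearCombination K d w =
          Finsupp.linearCombination K d w * Finsupp.linearCombination K d v := by
        intro v w
        induction v using Finsupp.induction_linear with
        | zero => simp
        | add f g hf hg => simp only [map_add, hf, hg, mul_add, add_mul]
        | single n c =>
          induction w using Finsupp.induction_linear with
          | zero => simp
          | add f g hf hg => simp only [map_add, hf, hg, mul_add, add_mul]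
          | single m e =>
            simp only [Finsupp.linearCombination_single, mul_smul_comm, smul_mul_assoc, hdd n m]
            rw [smul_comm]
      simp only [lie_d, lie_y, lie_x, map_add, map_sub, map_smul, h1, h2,
        LieRing.of_associative_ring_bracket, mul_add, add_mul, mul_smul_comm, smul_mul_assoc,
        h3 a.d b.d]
      have hyx' : y * x = x * y + x := by rw [add_comm]; exact sub_eq_iff_eq_add.mp hyx
      simp only [hyx']
      module }

theorem toAssoc_apply {A : Type*} [Ring A] [Algebra K A] (y x : A) (d : ℕ+ → A)
    (hyx hyd hxd hdd) (a : LieH K) : toAssoc K y x d hyx hyd hxd hdd a =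
      a.y • y + a.x • x + Finsupp.linearCombination K d a.d := rfl

end LieH

/-! ## The Hopf algebra `H` -/

section Recursion

variable {K} {A : Type*} [Ring A] [Algebra K A]

/-- `d_1 = d`, `d_{n+1} = [x, d_n]`. -/
def dseq (x d : A) (n : ℕ+) : A := PNat.recOn n d fun _ a => x * a - a * x

theorem dseq_one (x d : A) : dseq x d 1 = d := PNat.recOn_one _ _

theorem dseq_succ (x d : A) (n : ℕ+) :
    dseq x d (n + 1) = x * dseq x d n - dseq x d n * x := PNat.recOn_succ _ _ _

theorem dseq_weight (y x d : A) (hyx : y * x - x * y = x) (hyd : y * d - d * y = d) (n : ℕ+) :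
    y * dseq x d n - dseq x d n * y = ((n : ℕ) : K) • dseq x d n := by
  induction n using PNat.recOn with
  | one => simpa [dseq_one] using hyd
  | succ n ih =>
    set e := dseq x d n
    have h1 : y * x = x + x * y := sub_eq_iff_eq_add.mp hyx
    have h2 : y * e = ((n : ℕ) : K) • e + e * y := sub_eq_iff_eq_add.mp ih
    have h3 : y * (x * e) = x * e + ((n : ℕ) : K) • (x * e) + x * (e * y) := by
      rw [← mul_assoc, h1, add_mul, mul_assoc x y e, h2, mul_add, mul_smul_comm, add_assoc]
    have h4 : y * (e * x) = ((n : ℕ) : K) • (e * x) + e * x + e * (x * y) := by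
      rw [← mul_assoc, h2, add_mul, mul_assoc e y x, h1, mul_add, smul_mul_assoc, add_assoc]
    rw [dseq_succ, mul_sub, h3, h4, sub_mul, mul_assoc, mul_assoc]
    push_cast
    module

theorem ad_mem (x : A) (s : Set A) (D : Subalgebra K A) (hD : Algebra.adjoin K s ≤ D)
    (h : ∀ a ∈ s, x * a - a * x ∈ D) {a : A} (ha : a ∈ Algebra.adjoin K s) :
    x * a - a * x ∈ D := by
  induction ha using Algebra.adjoin_induction with
  | mem a ha => exact h a ha
  | algebraMap r => rw [Algebra.commutes, sub_self]; exact D.zero_mem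
  | add a b _ _ ha hb =>
    have : x * (a + b) - (a + b) * x = (x * a - a * x) + (x * b - b * x) := by noncomm_ring
    rw [this]; exact D.add_mem ha hb
  | mul a b hA hB ha hb =>
    have : x * (a * b) - (a * b) * x = (x * a - a * x) * b + a * (x * b - b * x) := by
      noncomm_ring
    rw [this]
    exact D.add_mem (D.mul_mem ha (hD hB)) (D.mul_mem (hD hA) hb)

end Recursion

/-- The algebra `H`: the enveloping algebra of the Lie algebra spanned by `Y`, `X`, `δ_n`.
(This is a separate type because its coproduct is not the one of an enveloping algebra.) -/
def H : Type _ := UniversalEnvelopingAlgebra K (LieH K)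

namespace H

instance : Ring (H K) := inferInstanceAs (Ring (UniversalEnvelopingAlgebra K (LieH K)))
instance : Algebra K (H K) :=
  inferInstanceAs (Algebra K (UniversalEnvelopingAlgebra K (LieH K)))

/-- The inclusion of the Lie algebra in `H`. -/
def ι : LieH K →ₗ⁅K⁆ H K := UniversalEnvelopingAlgebra.ι K

variable {K} in
/-- Lie homomorphisms extend to `H`. -/
def lift {A : Type*} [Ring A] [Algebra K A] (f : LieH K →ₗ⁅K⁆ A) : H K →ₐ[K] A :=
  UniversalEnvelopingAlgebra.lift K f

variable {K} in
theorem lift_ι {A : Type*} [Ring A] [Algebra K A] (f : LieH K →ₗ⁅K⁆ A) (a : LieH K) :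
    lift f (ι K a) = f a := UniversalEnvelopingAlgebra.lift_ι_apply K f a

/-- The generator `Y` of `H`. -/
def Y : H K := ι K (LieH.Y K)
/-- The generator `X` of `H`. -/
def X : H K := ι K (LieH.X K)
/-- The generator `δ_n` of `H`. -/
def δ (n : ℕ+) : H K := ι K (LieH.δ K n)

theorem Y_X : Y K * X K - X K * Y K = X K := by
  have h := (ι K).map_lie (LieH.Y K) (LieH.X K)
  rw [LieH.lie_Y_X, LieRing.of_associative_ring_bracket] at h
  exact h.symm

theorem Y_δ (n : ℕ+) : Y K * δ K n - δ K n * Y K = ((n : ℕ) : K) • δ K n := by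
  have h := (ι K).map_lie (LieH.Y K) (LieH.δ K n)
  rw [LieH.lie_Y_δ, LieRing.of_associative_ring_bracket, map_smul] at h
  exact h.symm

theorem X_δ (n : ℕ+) : X K * δ K n - δ K n * X K = δ K (n + 1) := by
  have h := (ι K).map_lie (LieH.X K) (LieH.δ K n)
  rw [LieH.lie_X_δ, LieRing.of_associative_ring_bracket] at h
  exact h.symm

theorem δ_comm (n m : ℕ+) : δ K n * δ K m = δ K m * δ K n := by
  have h := (ι K).map_lie (LieH.δ K n) (LieH.δ K m)
  rw [LieH.lie_δ_δ, LieRing.of_associative_ring_bracket, map_zero] at h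
  exact sub_eq_zero.mp h.symm

/-- `H` is generated by `Y`, `X`, `δ_1`. -/
theorem adjoin_eq_top : Algebra.adjoin K ({Y K, X K, δ K 1} : Set (H K)) = ⊤ := by
  set B := Algebra.adjoin K ({Y K, X K, δ K 1} : Set (H K)) with hB
  have hY : Y K ∈ B := Algebra.subset_adjoin (by simp)
  have hX : X K ∈ B := Algebra.subset_adjoin (by simp)
  have hδ : ∀ n, δ K n ∈ B := by
    intro n
    induction n using PNat.recOn with
    | one => exact Algebra.subset_adjoin (by simp)
    | succ n ih =>
      rw [← X_δ]; exact B.sub_mem (B.mul_mem hX ih) (B.mul_mem ih hX)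
  rw [eq_top_iff]
  refine le_trans (UEA.adjoin_range_ι K (LieH K)).ge (Algebra.adjoin_le ?_)
  rintro _ ⟨a, rfl⟩
  have ha : a = a.y • LieH.Y K + a.x • LieH.X K +
      Finsupp.linearCombination K (LieH.δ K) a.d := by
    have h3 : ∀ v : ℕ+ →₀ K, Finsupp.linearCombination K (LieH.δ K) v = ⟨0, 0, v⟩ := by
      intro v
      induction v using Finsupp.induction_linear with
      | zero => rfl
      | add f g hf hg => rw [map_add, hf, hg]; ext1 <;> simp
      | single n c => rw [Finsupp.linearCombination_single]; ext1 <;> simp [LieH.δ]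
    rw [h3]; ext1 <;> simp [LieH.Y, LieH.X]
  change ι K a ∈ B
  rw [ha, map_add, map_add, map_smul, map_smul]
  refine B.add_mem (B.add_mem (B.smul_mem hY _) (B.smul_mem hX _)) ?_
  induction a.d using Finsupp.induction_linear with
  | zero => simp
  | add f g hf hg => rw [map_add, map_add]; exact B.add_mem hf hg
  | single n c =>
    rw [Finsupp.linearCombination_single, map_smul]; exact B.smul_mem (hδ n) _

/-- The elements `δ_1, …, δ_n`. -/
def gens (n : ℕ) : Set (H K) := {a | ∃ k : ℕ+, (k : ℕ) ≤ n ∧ a = δ K k}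

/-- The elements `δ_k ⊗ 1` and `1 ⊗ δ_k` with `k ≤ n`. -/
def gens₂ (n : ℕ) : Set (H K ⊗[K] H K) :=
  {t | ∃ k : ℕ+, (k : ℕ) ≤ n ∧ (t = δ K k ⊗ₜ 1 ∨ t = 1 ⊗ₜ δ K k)}

theorem gens_mono {n m : ℕ} (h : n ≤ m) : gens K n ⊆ gens K m := by
  rintro _ ⟨k, hk, rfl⟩; exact ⟨k, hk.trans h, rfl⟩

theorem gens₂_mono {n m : ℕ} (h : n ≤ m) : gens₂ K n ⊆ gens₂ K m := by
  rintro _ ⟨k, hk, ht⟩; exact ⟨k, hk.trans h, ht⟩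

/-! ### The coproduct -/

/-- `Δ Y`. -/
def ΔY : H K ⊗[K] H K := Y K ⊗ₜ 1 + 1 ⊗ₜ Y K
/-- `Δ X`. -/
def ΔX : H K ⊗[K] H K := X K ⊗ₜ 1 + 1 ⊗ₜ X K + δ K 1 ⊗ₜ Y K
/-- `Δ δ_n`, defined inductively by `Δ δ_1 = δ_1 ⊗ 1 + 1 ⊗ δ_1` and
`Δ δ_{n+1} = [Δ X, Δ δ_n]`. -/
def Δδ : ℕ+ → H K ⊗[K] H K := dseq (ΔX K) (δ K 1 ⊗ₜ 1 + 1 ⊗ₜ δ K 1)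

theorem ΔY_ΔX : ΔY K * ΔX K - ΔX K * ΔY K = ΔX K := by
  have h1 : Y K * X K = X K + X K * Y K := sub_eq_iff_eq_add.mp (Y_X K)
  have h2 : Y K * δ K 1 = δ K 1 + δ K 1 * Y K := by
    have := sub_eq_iff_eq_add.mp (Y_δ K 1); simpa using this
  simp only [ΔY, ΔX, mul_add, add_mul, Algebra.TensorProduct.tmul_mul_tmul, one_mul, mul_one,
    h1, h2, TensorProduct.add_tmul, TensorProduct.tmul_add]
  abel

theorem ΔY_Δδ_one : ΔY K * (δ K 1 ⊗ₜ 1 + 1 ⊗ₜ δ K 1) - (δ K 1 ⊗ₜ 1 + 1 ⊗ₜ δ K 1) * ΔY K =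
    δ K 1 ⊗ₜ 1 + 1 ⊗ₜ δ K 1 := by
  have h2 : Y K * δ K 1 = δ K 1 + δ K 1 * Y K := by
    have := sub_eq_iff_eq_add.mp (Y_δ K 1); simpa using this
  simp only [ΔY, mul_add, add_mul, Algebra.TensorProduct.tmul_mul_tmul, one_mul, mul_one,
    h2, TensorProduct.add_tmul, TensorProduct.tmul_add]
  abel

theorem Δδ_mem (n : ℕ+) : Δδ K n ∈ Algebra.adjoin K (gens₂ K n) := by
  induction n using PNat.recOn with
  | one =>
    rw [Δδ, dseq_one]
    exact Subalgebra.add_mem _ (Algebra.subset_adjoin ⟨1, le_rfl, Or.inl rfl⟩)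
      (Algebra.subset_adjoin ⟨1, le_rfl, Or.inr rfl⟩)
  | succ n ih =>
    rw [Δδ, dseq_succ]
    have hm : Algebra.adjoin K (gens₂ K n) ≤ Algebra.adjoin K (gens₂ K (n + 1 : ℕ+)) :=
      Algebra.adjoin_mono (gens₂_mono K (by simp))
    refine ad_mem _ (gens₂ K n) _ hm ?_ ih
    rintro _ ⟨k, hk, rfl | rfl⟩
    · have : ΔX K * δ K k ⊗ₜ 1 - δ K k ⊗ₜ 1 * ΔX K = δ K (k + 1) ⊗ₜ 1 := by
        simp only [ΔX, add_mul, mul_add, Algebra.TensorProduct.tmul_mul_tmul, one_mul, mul_one,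
          δ_comm K 1 k, ← X_δ, TensorProduct.sub_tmul]
        abel
      rw [this]
      exact Algebra.subset_adjoin ⟨k + 1, by simpa using hk, Or.inl rfl⟩
    · have : ΔX K * 1 ⊗ₜ δ K k - 1 ⊗ₜ δ K k * ΔX K =
          1 ⊗ₜ δ K (k + 1) + ((k : ℕ) : K) • (δ K 1 ⊗ₜ 1 * 1 ⊗ₜ δ K k) := by
        have h2 : Y K * δ K k = ((k : ℕ) : K) • δ K k + δ K k * Y K :=
          sub_eq_iff_eq_add.mp (Y_δ K k)
        simp only [ΔX, add_mul, mul_add, Algebra.TensorProduct.tmul_mul_tmul, one_mul, mul_one,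
          h2, ← X_δ, TensorProduct.tmul_sub, TensorProduct.tmul_add, TensorProduct.tmul_smul]
        abel
      rw [this]
      refine Subalgebra.add_mem _ (Algebra.subset_adjoin ⟨k + 1, by simpa using hk, Or.inr rfl⟩)
        (Subalgebra.smul_mem _ (Subalgebra.mul_mem _ ?_ ?_) _)
      · exact Algebra.subset_adjoin ⟨1, by simp, Or.inl rfl⟩
      · exact Algebra.subset_adjoin ⟨k, hk.trans (by simp), Or.inr rfl⟩

theorem comm_of_mem_adjoin {A : Type*} [Ring A] [Algebra K A] {s : Set A}
    (hs : ∀ a ∈ s, ∀ b ∈ s, a * b = b * a) {a b : A}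
    (ha : a ∈ Algebra.adjoin K s) (hb : b ∈ Algebra.adjoin K s) : a * b = b * a := by
  have h1 : ∀ c ∈ s, Commute c a := fun c hc =>
    Algebra.commute_of_mem_adjoin_of_forall_mem_commute ha fun d hd => hs c hc d hd
  exact (Algebra.commute_of_mem_adjoin_of_forall_mem_commute hb fun c hc => (h1 c hc).symm).eq

theorem gens₂_comm (n : ℕ) : ∀ a ∈ gens₂ K n, ∀ b ∈ gens₂ K n, a * b = b * a := by
  rintro _ ⟨k, _, rfl | rfl⟩ _ ⟨l, _, rfl | rfl⟩ <;>
    simp [δ_comm K k l]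

theorem Δδ_comm (n m : ℕ+) : Δδ K n * Δδ K m = Δδ K m * Δδ K n :=
  comm_of_mem_adjoin K (gens₂_comm K (max n m : ℕ))
    (Algebra.adjoin_mono (gens₂_mono K (le_max_left _ _)) (Δδ_mem K n))
    (Algebra.adjoin_mono (gens₂_mono K (le_max_right _ _)) (Δδ_mem K m))

theorem ΔY_Δδ (n : ℕ+) : ΔY K * Δδ K n - Δδ K n * ΔY K = ((n : ℕ) : K) • Δδ K n :=
  dseq_weight _ _ _ (ΔY_ΔX K) (ΔY_Δδ_one K) n

theorem ΔX_Δδ (n : ℕ+) : ΔX K * Δδ K n - Δδ K n * ΔX K = Δδ K (n + 1) :=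
  (dseq_succ _ _ n).symm

/-- The coproduct of `H`, an algebra homomorphism. -/
def comulHom : H K →ₐ[K] H K ⊗[K] H K :=
  lift (LieH.toAssoc K (ΔY K) (ΔX K) (Δδ K) (ΔY_ΔX K) (ΔY_Δδ K) (ΔX_Δδ K)
    (Δδ_comm K))

theorem comulHom_Y : comulHom K (Y K) = Y K ⊗ₜ 1 + 1 ⊗ₜ Y K := by
  refine (lift_ι _ _).trans ?_; rw [LieH.toAssoc_apply]; simp [LieH.Y, ΔY]

theorem comulHom_X : comulHom K (X K) = X K ⊗ₜ 1 + 1 ⊗ₜ X K + δ K 1 ⊗ₜ Y K := by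
  refine (lift_ι _ _).trans ?_; rw [LieH.toAssoc_apply]; simp [LieH.X, ΔX]

theorem comulHom_δ (n : ℕ+) : comulHom K (δ K n) = Δδ K n := by
  refine (lift_ι _ _).trans ?_; rw [LieH.toAssoc_apply]; simp [LieH.δ]

theorem comulHom_δ_one : comulHom K (δ K 1) = δ K 1 ⊗ₜ 1 + 1 ⊗ₜ δ K 1 := by
  rw [comulHom_δ, Δδ, dseq_one]

/-- The counit of `H`, killing `Y`, `X` and the `δ_n`. -/
def counitHom : H K →ₐ[K] K := lift (0 : LieH K →ₗ⁅K⁆ K)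

theorem counitHom_Y : counitHom K (Y K) = 0 := lift_ι _ _
theorem counitHom_X : counitHom K (X K) = 0 := lift_ι _ _
theorem counitHom_δ (n : ℕ+) : counitHom K (δ K n) = 0 := lift_ι _ _

instance instBialgebra : Bialgebra K (H K) :=
  Bialgebra.ofAlgHom (comulHom K) (counitHom K)
    (by
      apply AlgHom.ext_of_adjoin_eq_top (adjoin_eq_top K)
      rintro _ (rfl | rfl | rfl) <;>
      · simp [comulHom_Y, comulHom_X, comulHom_δ_one, Algebra.TensorProduct.one_def,
          TensorProduct.add_tmul, TensorProduct.tmul_add]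
        abel)
    (by
      apply AlgHom.ext_of_adjoin_eq_top (adjoin_eq_top K)
      rintro _ (rfl | rfl | rfl) <;>
        simp [comulHom_Y, comulHom_X, comulHom_δ_one, counitHom_Y, counitHom_X, counitHom_δ])
    (by
      apply AlgHom.ext_of_adjoin_eq_top (adjoin_eq_top K)
      rintro _ (rfl | rfl | rfl) <;>
        simp [comulHom_Y, comulHom_X, comulHom_δ_one, counitHom_Y, counitHom_X, counitHom_δ])

/-! ### The antipode -/

/-- `S X = -X + δ_1 Y`. -/
def SX : H K := -X K + δ K 1 * Y K

/-- The recursion `S δ_1 = -δ_1`, `S δ_{n+1} = S [X, δ_n] = [S δ_n, S X]`, written in the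
opposite algebra. -/
def Sδ : ℕ+ → (H K)ᵐᵒᵖ := dseq (MulOpposite.op (SX K)) (MulOpposite.op (-δ K 1))

theorem SY_SX : MulOpposite.op (-Y K) * MulOpposite.op (SX K) -
    MulOpposite.op (SX K) * MulOpposite.op (-Y K) = MulOpposite.op (SX K) := by
  have h1 : Y K * X K = X K + X K * Y K := sub_eq_iff_eq_add.mp (Y_X K)
  have h2 : Y K * (δ K 1 * Y K) = δ K 1 * Y K + δ K 1 * Y K * Y K := by
    have := sub_eq_iff_eq_add.mp (Y_δ K 1)
    rw [← mul_assoc, this]; simp [add_mul]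
  rw [← MulOpposite.op_mul, ← MulOpposite.op_mul, ← MulOpposite.op_sub]
  congr 1
  simp only [SX, add_mul, mul_add, neg_mul, mul_neg, neg_neg, h1, h2]
  abel

theorem SY_Sδ_one : MulOpposite.op (-Y K) * MulOpposite.op (-δ K 1) -
    MulOpposite.op (-δ K 1) * MulOpposite.op (-Y K) = MulOpposite.op (-δ K 1) := by
  have h2 : Y K * δ K 1 = δ K 1 + δ K 1 * Y K := by
    have := sub_eq_iff_eq_add.mp (Y_δ K 1); simpa using this
  rw [← MulOpposite.op_mul, ← MulOpposite.op_mul, ← MulOpposite.op_sub]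
  congr 1
  simp only [neg_mul, mul_neg, neg_neg, h2]
  abel

theorem Sδ_mem (n : ℕ+) : (Sδ K n).unop ∈ Algebra.adjoin K (gens K n) := by
  induction n using PNat.recOn with
  | one =>
    rw [Sδ, dseq_one]
    exact Subalgebra.neg_mem _ (Algebra.subset_adjoin ⟨1, le_rfl, rfl⟩)
  | succ n ih =>
    have h0 : (Sδ K (n + 1)).unop =
        (-SX K) * (Sδ K n).unop - (Sδ K n).unop * (-SX K) := by
      rw [Sδ, dseq_succ]
      simp only [MulOpposite.unop_sub, MulOpposite.unop_mul, MulOpposite.unop_op]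
      noncomm_ring
    rw [h0]
    have hm : Algebra.adjoin K (gens K n) ≤ Algebra.adjoin K (gens K (n + 1 : ℕ+)) :=
      Algebra.adjoin_mono (gens_mono K (by simp))
    refine ad_mem _ (gens K n) _ hm ?_ ih
    rintro _ ⟨k, hk, rfl⟩
    have : (-SX K) * δ K k - δ K k * (-SX K) =
        δ K (k + 1) - ((k : ℕ) : K) • (δ K 1 * δ K k) := by
      have h2 : Y K * δ K k = ((k : ℕ) : K) • δ K k + δ K k * Y K :=
        sub_eq_iff_eq_add.mp (Y_δ K k)
      have h3 : δ K 1 * Y K * δ K k =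
          ((k : ℕ) : K) • (δ K 1 * δ K k) + δ K k * (δ K 1 * Y K) := by
        rw [mul_assoc, h2, mul_add, mul_smul_comm, ← mul_assoc, ← mul_assoc, δ_comm K 1 k]
      simp only [SX, add_mul, mul_add, neg_add, neg_mul, mul_neg, neg_neg, h3, ← X_δ]
      abel
    rw [this]
    refine Subalgebra.sub_mem _ (Algebra.subset_adjoin ⟨k + 1, by simpa using hk, rfl⟩)
      (Subalgebra.smul_mem _ (Subalgebra.mul_mem _ ?_ ?_) _)
    · exact Algebra.subset_adjoin ⟨1, by simp, rfl⟩
    · exact Algebra.subset_adjoin ⟨k, hk.trans (by simp), rfl⟩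

theorem gens_comm (n : ℕ) : ∀ a ∈ gens K n, ∀ b ∈ gens K n, a * b = b * a := by
  rintro _ ⟨k, _, rfl⟩ _ ⟨l, _, rfl⟩
  exact δ_comm K k l

theorem Sδ_comm (n m : ℕ+) : Sδ K n * Sδ K m = Sδ K m * Sδ K n := by
  apply MulOpposite.unop_injective
  rw [MulOpposite.unop_mul, MulOpposite.unop_mul]
  exact comm_of_mem_adjoin K (gens_comm K (max n m : ℕ))
    (Algebra.adjoin_mono (gens_mono K (le_max_right _ _)) (Sδ_mem K m))
    (Algebra.adjoin_mono (gens_mono K (le_max_left _ _)) (Sδ_mem K n))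

theorem SY_Sδ (n : ℕ+) : MulOpposite.op (-Y K) * Sδ K n - Sδ K n * MulOpposite.op (-Y K) =
    ((n : ℕ) : K) • Sδ K n :=
  dseq_weight _ _ _ (SY_SX K) (SY_Sδ_one K) n

theorem SX_Sδ (n : ℕ+) : MulOpposite.op (SX K) * Sδ K n - Sδ K n * MulOpposite.op (SX K) =
    Sδ K (n + 1) :=
  (dseq_succ _ _ n).symm

/-- The antipode of `H` as an anti-homomorphism. -/
def antipodeHom : H K →ₐ[K] (H K)ᵐᵒᵖ :=
  lift (LieH.toAssoc K (MulOpposite.op (-Y K)) (MulOpposite.op (SX K)) (Sδ K) (SY_SX K)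
    (SY_Sδ K) (SX_Sδ K) (Sδ_comm K))

theorem antipodeHom_Y : antipodeHom K (Y K) = MulOpposite.op (-Y K) := by
  refine (lift_ι _ _).trans ?_; rw [LieH.toAssoc_apply]; simp [LieH.Y]

theorem antipodeHom_X : antipodeHom K (X K) = MulOpposite.op (SX K) := by
  refine (lift_ι _ _).trans ?_; rw [LieH.toAssoc_apply]; simp [LieH.X]

theorem antipodeHom_δ (n : ℕ+) : antipodeHom K (δ K n) = Sδ K n := by
  refine (lift_ι _ _).trans ?_; rw [LieH.toAssoc_apply]; simp [LieH.δ]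

theorem comul_Y : Coalgebra.comul (R := K) (Y K) = Y K ⊗ₜ[K] 1 + 1 ⊗ₜ Y K := comulHom_Y K
theorem comul_X : Coalgebra.comul (R := K) (X K) =
    X K ⊗ₜ[K] 1 + 1 ⊗ₜ X K + δ K 1 ⊗ₜ Y K := comulHom_X K
theorem comul_δ_one : Coalgebra.comul (R := K) (δ K 1) = δ K 1 ⊗ₜ[K] 1 + 1 ⊗ₜ δ K 1 :=
  comulHom_δ_one K
theorem counit_Y : Coalgebra.counit (R := K) (Y K) = 0 := counitHom_Y K
theorem counit_X : Coalgebra.counit (R := K) (X K) = 0 := counitHom_X K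
theorem counit_δ (n : ℕ+) : Coalgebra.counit (R := K) (δ K n) = 0 := counitHom_δ K n

instance instHopfAlgebra : HopfAlgebra K (H K) :=
  HopfAux.hopfOfGenerators (antipodeHom K) _ (adjoin_eq_top K)
    (by
      rintro _ (rfl | rfl | rfl) <;>
      simp [comul_Y, comul_X, comul_δ_one, counit_Y, counit_X, counit_δ, SX, Sδ, dseq_one,
        HopfAux.unopLin_apply, antipodeHom_Y, antipodeHom_X, antipodeHom_δ])
    (by
      rintro _ (rfl | rfl | rfl) <;>
      simp [comul_Y, comul_X, comul_δ_one, counit_Y, counit_X, counit_δ, SX, Sδ, dseq_one,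
        HopfAux.unopLin_apply, antipodeHom_Y, antipodeHom_X, antipodeHom_δ])

end H

/-! ## The Hopf algebras `H_n` -/

/-- `H_n`, the subalgebra of `H` generated by `δ_1, …, δ_n`. -/
def Hn (n : ℕ) : Subalgebra K (H K) := Algebra.adjoin K {a | ∃ k : ℕ+, (k : ℕ) ≤ n ∧ a = H.δ K k}

namespace Hn

theorem comul_mem (n : ℕ) : ∀ b ∈ Hn K n,
    Coalgebra.comul (R := K) b ∈ (HopfAux.incl₂ (Hn K n)).range := by
  have h1 : Algebra.adjoin K (H.gens₂ K n) ≤ (HopfAux.incl₂ (Hn K n)).range := by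
    refine Algebra.adjoin_le ?_
    rintro _ ⟨k, hk, rfl | rfl⟩
    · exact ⟨⟨H.δ K k, Algebra.subset_adjoin ⟨k, hk, rfl⟩⟩ ⊗ₜ 1, by simp [HopfAux.incl₂]⟩
    · exact ⟨1 ⊗ₜ ⟨H.δ K k, Algebra.subset_adjoin ⟨k, hk, rfl⟩⟩, by simp [HopfAux.incl₂]⟩
  intro b hb
  have h2 : Hn K n ≤ (HopfAux.incl₂ (Hn K n)).range.comap (Bialgebra.comulAlgHom K (H K)) := by
    refine Algebra.adjoin_le ?_
    rintro _ ⟨k, hk, rfl⟩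
    refine h1 (Algebra.adjoin_mono (H.gens₂_mono K hk) ?_)
    have := H.Δδ_mem K k
    rw [← H.comulHom_δ] at this
    exact this
  exact h2 hb

theorem antipode_mem (n : ℕ) : ∀ b ∈ Hn K n, HopfAlgebra.antipode K b ∈ Hn K n := by
  intro b hb
  change (H.antipodeHom K b).unop ∈ Hn K n
  induction hb using Algebra.adjoin_induction with
  | mem a ha =>
    obtain ⟨k, hk, rfl⟩ := ha
    rw [H.antipodeHom_δ]
    exact Algebra.adjoin_mono (H.gens_mono K hk) (H.Sδ_mem K k)
  | algebraMap r => rw [AlgHom.commutes]; exact (Hn K n).algebraMap_mem r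
  | add a b _ _ ha hb => rw [map_add]; exact (Hn K n).add_mem ha hb
  | mul a b _ _ ha hb => rw [map_mul]; exact (Hn K n).mul_mem hb ha

/-- `H_n` with the coproduct, counit and antipode of `H`. -/
instance instHopfAlgebra (n : ℕ) : HopfAlgebra K (Hn K n) :=
  HopfAux.subHopf (Hn K n) (comul_mem K n) (antipode_mem K n)

/-- `δ_k` as an element of `H_n`, for `k ≤ n`. -/
def δ (n : ℕ) (k : ℕ+) (hk : (k : ℕ) ≤ n) : Hn K n :=
  ⟨H.δ K k, Algebra.subset_adjoin ⟨k, hk, rfl⟩⟩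

end Hn

/-! ## Jets of vector fields -/

variable {K} in
/-- If `f(x)∂` vanishes to order `m` at `0`, then so does `f(x) g'(x)` for every `g`. -/
theorem X_pow_dvd_derivation (D : Derivation K K⟦X⟧ K⟦X⟧) (m : ℕ)
    (hD : (PowerSeries.X : K⟦X⟧) ^ m ∣ D PowerSeries.X) (g : K⟦X⟧) :
    (PowerSeries.X : K⟦X⟧) ^ m ∣ D g := by
  have hpow : ∀ k, (PowerSeries.X : K⟦X⟧) ^ m ∣ D (PowerSeries.X ^ k) := by
    intro k
    rw [Derivation.leibniz_pow, smul_eq_mul]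
    exact dvd_smul_of_dvd _ (hD.mul_left _)
  have hpoly : ∀ p : Polynomial K, (PowerSeries.X : K⟦X⟧) ^ m ∣ D (p : K⟦X⟧) := by
    intro p
    induction p using Polynomial.induction_on' with
    | add p q hp hq => rw [Polynomial.coe_add, map_add]; exact dvd_add hp hq
    | monomial k a =>
      have : ((Polynomial.monomial k a : Polynomial K) : K⟦X⟧) =
          a • (PowerSeries.X : K⟦X⟧) ^ k := by
        ext i
        rw [Polynomial.coeff_coe, Polynomial.coeff_monomial, map_smul, PowerSeries.coeff_X_pow,
          smul_eq_mul, mul_ite, mul_one, mul_zero]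
        exact if_congr eq_comm rfl rfl
      rw [this, Derivation.map_smul]
      exact dvd_smul_of_dvd _ (hpow k)
  have h1 : (PowerSeries.X : K⟦X⟧) ^ m ∣ g - (PowerSeries.trunc m g : Polynomial K) := by
    rw [PowerSeries.X_pow_dvd_iff]
    intro i hi
    rw [map_sub, Polynomial.coeff_coe, PowerSeries.coeff_trunc, if_pos hi, sub_self]
  obtain ⟨q, hq⟩ := h1
  have hg : g = PowerSeries.X ^ m * q + ((PowerSeries.trunc m g : Polynomial K) : K⟦X⟧) := by
    rw [← hq, sub_add_cancel]
  rw [hg, map_add, Derivation.leibniz, smul_eq_mul, smul_eq_mul]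
  exact dvd_add (dvd_add (dvd_mul_right _ _) ((hpow m).mul_left _)) (hpoly _)

/-- The Lie algebra of formal vector fields `f(x) ∂/∂x` with `f(0) = f'(0) = 0`. Formal vector
fields are the derivations `D` of the algebra of formal power series; `f` is `D(x)`. -/
def A1 : LieSubalgebra K (Derivation K K⟦X⟧ K⟦X⟧) where
  carrier := {D | (PowerSeries.X : K⟦X⟧) ^ 2 ∣ D PowerSeries.X}
  add_mem' := fun ha hb => dvd_add ha hb
  zero_mem' := dvd_zero _
  smul_mem' := fun c _ ha => dvd_smul_of_dvd c ha
  lie_mem' := fun {a b} ha hb => by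
    change _ ∣ ⁅a, b⁆ PowerSeries.X
    rw [Derivation.commutator_apply]
    exact dvd_sub (X_pow_dvd_derivation a 2 ha _) (X_pow_dvd_derivation b 2 hb _)

/-- The ideal of the vector fields `f(x) ∂/∂x` with `f` divisible by `x^{n+2}`. -/
def A1Ideal (n : ℕ) : LieIdeal K (A1 K) where
  carrier := {D | (PowerSeries.X : K⟦X⟧) ^ (n + 2) ∣ D.1 PowerSeries.X}
  add_mem' := fun ha hb => dvd_add ha hb
  zero_mem' := dvd_zero _
  smul_mem' := fun c _ ha => dvd_smul_of_dvd c ha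
  lie_mem := fun {a b} hb => by
    change _ ∣ ⁅a.1, b.1⁆ PowerSeries.X
    rw [Derivation.commutator_apply]
    refine dvd_sub ?_ (X_pow_dvd_derivation b.1 (n + 2) hb _)
    obtain ⟨q, hq⟩ := hb
    obtain ⟨r, hr⟩ := a.2
    rw [hq, Derivation.leibniz, Derivation.leibniz_pow, hr]
    refine dvd_add (dvd_mul_right _ _) ⟨(n + 2 : ℕ) • (q * r) * PowerSeries.X, ?_⟩
    simp only [smul_eq_mul, nsmul_eq_mul, show n + 2 - 1 = n + 1 from rfl]
    ring

/-- The Lie algebra of `(n+1)`-jets of vector fields vanishing to order `2` at `0`. -/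
def A1n (n : ℕ) : Type _ := A1 K ⧸ A1Ideal K n

instance (n : ℕ) : LieRing (A1n K n) := inferInstanceAs (LieRing (A1 K ⧸ A1Ideal K n))
instance (n : ℕ) : LieAlgebra K (A1n K n) :=
  inferInstanceAs (LieAlgebra K (A1 K ⧸ A1Ideal K n))

/-- The vector field `Z_k = x^{k+1} / (k+1)! ∂/∂x`. -/
def zField (k : ℕ+) : A1 K :=
  ⟨((((k : ℕ) + 1).factorial : K)⁻¹ • (PowerSeries.X : K⟦X⟧) ^ ((k : ℕ) + 1)) •
      PowerSeries.derivative K, by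
    change (PowerSeries.X : K⟦X⟧) ^ 2 ∣ _
    rw [Derivation.smul_apply, PowerSeries.derivative_X, smul_eq_mul, mul_one]
    exact dvd_smul_of_dvd _ (pow_dvd_pow _ (by have := k.pos; omega))⟩

/-- The jet of the vector field `Z_k`. -/
def Z (n : ℕ) (k : ℕ+) : A1n K n := LieSubmodule.Quotient.mk (N := A1Ideal K n) (zField K k)

/-! ## Restricted duals and Hopf pairings -/

/-- The restricted dual of `U(L)`: the linear forms vanishing on some power of the augmentation
ideal, i.e. those that are continuous for the adic topology of the augmentation ideal. -/
def restrictedDual (L : Type*) [LieRing L] [LieAlgebra K L] :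
    Submodule K (Module.Dual K (UniversalEnvelopingAlgebra K L)) where
  carrier := {f | ∃ m : ℕ, ∀ a ∈ (RingHom.ker
    (Bialgebra.counitAlgHom K (UniversalEnvelopingAlgebra K L))) ^ m, f a = 0}
  zero_mem' := ⟨0, fun _ _ => rfl⟩
  add_mem' := by
    rintro f g ⟨m, hf⟩ ⟨m', hg⟩
    refine ⟨max m m', fun a ha => ?_⟩
    rw [LinearMap.add_apply, hf a (Ideal.pow_le_pow_right (le_max_left _ _) ha),
      hg a (Ideal.pow_le_pow_right (le_max_right _ _) ha), add_zero]
  smul_mem' := by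
    rintro c f ⟨m, hf⟩
    exact ⟨m, fun a ha => by rw [LinearMap.smul_apply, hf a ha, smul_zero]⟩

/-- The part of weight `d` of the enveloping algebra of the jets, where `Z_k` has weight `k`:
the span of the products `Z_{k_1} ⋯ Z_{k_r}` with `k_1 + ⋯ + k_r = d`. -/
def weightSpace (n d : ℕ) : Submodule K (UniversalEnvelopingAlgebra K (A1n K n)) :=
  Submodule.span K {a | ∃ l : List ℕ+, (l.map fun k => (k : ℕ)).sum = d ∧
    a = (l.map fun k => UniversalEnvelopingAlgebra.ι K (Z K n k)).prod}

/-- The graded dual of the enveloping algebra of the jets: the linear forms that vanish in all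
sufficiently large weights. -/
def gradedDual (n : ℕ) : Submodule K (Module.Dual K (UniversalEnvelopingAlgebra K (A1n K n))) where
  carrier := {f | ∃ m : ℕ, ∀ d, m ≤ d → ∀ a ∈ weightSpace K n d, f a = 0}
  zero_mem' := ⟨0, fun _ _ _ _ => rfl⟩
  add_mem' := by
    rintro f g ⟨m, hf⟩ ⟨m', hg⟩
    refine ⟨max m m', fun d hd a ha => ?_⟩
    rw [LinearMap.add_apply, hf d (le_trans (le_max_left _ _) hd) a ha,
      hg d (le_trans (le_max_right _ _) hd) a ha, add_zero]
  smul_mem' := by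
    rintro c f ⟨m, hf⟩
    exact ⟨m, fun d hd a ha => by rw [LinearMap.smul_apply, hf d hd a ha, smul_zero]⟩

/-- `β` is a pairing of Hopf algebras: all the structure maps of `A` are the transposes of those
of `B`. -/
structure IsHopfPairing {A B : Type*} [Ring A] [HopfAlgebra K A] [Ring B] [HopfAlgebra K B]
    (β : A →ₗ[K] B →ₗ[K] K) : Prop where
  /-- `⟨p q, b⟩ = ⟨p ⊗ q, Δ b⟩` -/
  mul_left : ∀ (p q : A) (b : B),
    β (p * q) b = LinearMap.mul' K K (TensorProduct.map (β p) (β q) (Coalgebra.comul b))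
  /-- `⟨1, b⟩ = ε(b)` -/
  one_left : ∀ b : B, β 1 b = Coalgebra.counit b
  /-- `⟨p, b c⟩ = ⟨Δ p, b ⊗ c⟩` -/
  mul_right : ∀ (p : A) (b c : B),
    β p (b * c) = LinearMap.mul' K K (TensorProduct.map (β.flip b) (β.flip c) (Coalgebra.comul p))
  /-- `⟨p, 1⟩ = ε(p)` -/
  one_right : ∀ p : A, β p 1 = Coalgebra.counit p
  /-- `⟨S p, b⟩ = ⟨p, S b⟩` -/
  antipode : ∀ (p : A) (b : B), β (HopfAlgebra.antipode K p) b = β p (HopfAlgebra.antipode K b)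

end ConnesMoscovici

end

/-! A vector field `D` defines a linear form on `H_n`: take the part of `P` that is linear in the
`δ_k` and pair its coefficients with the coordinates `(k+1)! f_{k+1}` of `D`. This form is a
derivation over the counit, and such derivations are closed under the commutator of the convolution
algebra. The heart of the proof is that `D ↦` form is a Lie homomorphism (`Hn.fieldForm_lie`), which
has to be checked only on the `δ_j`. There, `Δδ_{j+1} = [ΔX, Δδ_j]` and Pascal's rule show that the
bilinear part of `Δδ_j` is the sum of `C(j, k+1) δ_k ⊗ δ_l` over `k + l = j` with `k, l ≥ 1`
(`H.linearPart₂_Δδ`); after antisymmetrization the same binomials describe the bracket of vector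
fields (`A1.coord_lie`).

The homomorphism kills the fields divisible by `x^{n+2}`, so it extends to the enveloping algebra of
the jets and gives the pairing. Products in `U` are transposed to `Δ` by construction. Products in
`H_n` are transposed to the coproduct of `U` because derivations match primitive elements. The
antipodes match because both give convolution inverses of the pairing.

For bijectivity, filter `H_n` by the powers of its augmentation ideal `I` and `U` by the length of
words in the `Z_k`. Words shorter than `s` are orthogonal to `I^s`; in equal degree a monomial in
the `δ_k` pairs to zero with every word except the rearrangements of its own letters, where the
value is a product of factorials, nonzero in characteristic zero. This triangularity gives
injectivity (`IsDualSystem.pairing_injective`) and builds preimages by induction on the length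
(`IsDualSystem.exists_agree_of_length_lt`). No basis of `U` is needed: words are symmetric modulo
shorter ones. The bracket with `Y` makes different weights orthogonal, so each `P` vanishes in large
weights; conversely the induction stops, since a word of weight less than `M` has length less than
`M`.

The two descriptions of the dual agree because a letter has weight between `1` and `n`, so that
length and weight bound each other (`restrictedDual_eq_gradedDual`). -/

noncomputable section

attribute [local instance 100] LieRing.ofAssociativeRing

/-! ## Derivations over the counit -/

section CounitDerivation

open Coalgebra

variable {K : Type*} [Field K] {A : Type*} [Ring A] [Bialgebra K A]

/-- `f` is a derivation with values in the trivial module `K`. -/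
def IsCounitDerivation (f : A →ₗ[K] K) : Prop :=
  ∀ a b, f (a * b) = f a * counit (R := K) b + counit (R := K) a * f b

theorem IsCounitDerivation.map_one {f : A →ₗ[K] K} (hf : IsCounitDerivation f) : f 1 = 0 := by
  have h := hf 1 1
  simpa using h

theorem IsCounitDerivation.ext_of_adjoin {f g : A →ₗ[K] K} (hf : IsCounitDerivation f)
    (hg : IsCounitDerivation g) {s : Set A} (hs : Algebra.adjoin K s = ⊤)
    (h : ∀ a ∈ s, f a = g a) : f = g := by
  ext a
  have ha : a ∈ Algebra.adjoin K s := hs ▸ Algebra.mem_top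
  induction ha using Algebra.adjoin_induction with
  | mem a ha => exact h a ha
  | algebraMap r => simp [Algebra.algebraMap_eq_smul_one, hf.map_one, hg.map_one]
  | add a b _ _ ha hb => simp only [map_add, ha, hb]
  | mul a b _ _ ha hb => rw [hf, hg, ha, hb]

/-- The contraction `a ↦ f(a₁) a₂`. -/
def leftSlice (f : A →ₗ[K] K) : A →ₗ[K] A :=
  (TensorProduct.lid K A).toLinearMap ∘ₗ f.rTensor A ∘ₗ comul

/-- In `(f ⊗ 1)(Δa Δb)` the form splits by the Leibniz rule on the first factors, and the counit
axiom turns the side that `f` does not touch back into `a` or `b`. -/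
theorem IsCounitDerivation.leftSlice_mul {f : A →ₗ[K] K} (hf : IsCounitDerivation f) (a b : A) :
    leftSlice f (a * b) = leftSlice f a * b + a * leftSlice f b := by
  have key : ∀ t u : A ⊗[K] A, TensorProduct.lid K A (f.rTensor A (t * u)) =
      TensorProduct.lid K A (f.rTensor A t) *
        TensorProduct.lid K A ((counit (R := K) (A := A)).rTensor A u) +
      TensorProduct.lid K A ((counit (R := K) (A := A)).rTensor A t) *
        TensorProduct.lid K A (f.rTensor A u) := by
    intro t u
    induction t using TensorProduct.induction_on with
    | zero => simp
    | add t t' ht ht' => simp only [add_mul, map_add, ht, ht']; abel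
    | tmul p q =>
      induction u using TensorProduct.induction_on with
      | zero => simp
      | add t t' ht ht' => simp only [mul_add, map_add, ht, ht']; abel
      | tmul p' q' => simp only [Algebra.TensorProduct.tmul_mul_tmul, LinearMap.rTensor_tmul,
          TensorProduct.lid_tmul, hf p p', smul_mul_smul_comm, add_smul]
  have := key (comul a) (comul b)
  rw [rTensor_counit_comul, rTensor_counit_comul] at this
  simpa [leftSlice] using this

theorem counit_leftSlice (f : A →ₗ[K] K) (a : A) : counit (R := K) (leftSlice f a) = f a := by
  have key : ∀ t : A ⊗[K] A, counit (R := K) (TensorProduct.lid K A (f.rTensor A t)) =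
      f (TensorProduct.rid K A ((counit (R := K) (A := A)).lTensor A t)) := by
    intro t
    induction t using TensorProduct.induction_on with
    | zero => simp
    | add t t' ht ht' => simp only [map_add, ht, ht']
    | tmul p q => simp [mul_comm]
  have := key (comul a)
  rw [lTensor_counit_comul] at this
  simpa [leftSlice] using this

/-- The convolution `f * g` becomes `g` composed with a derivation of `A`, so convolution products
can be computed with the Leibniz rule. -/
theorem map_comul_eq_leftSlice (f g : A →ₗ[K] K) (a : A) :
    LinearMap.mul' K K (TensorProduct.map f g (comul a)) = g (leftSlice f a) := by
  have key : ∀ t : A ⊗[K] A, LinearMap.mul' K K (TensorProduct.map f g t) =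
      g (TensorProduct.lid K A (f.rTensor A t)) := by
    intro t
    induction t using TensorProduct.induction_on with
    | zero => simp
    | add t t' ht ht' => simp only [map_add, ht, ht']
    | tmul p q => simp
  exact key (comul a)

/-- The defect of `f * g` from being a derivation is `f(a) g(b) + g(a) f(b)`. It is symmetric in `f`
and `g`, hence cancels in the commutator. -/
theorem IsCounitDerivation.convMul_sub {f g : WithConv (A →ₗ[K] K)}
    (hf : IsCounitDerivation f.ofConv) (hg : IsCounitDerivation g.ofConv) :
    IsCounitDerivation (f * g - g * f).ofConv := by
  have h : ∀ f g : WithConv (A →ₗ[K] K), IsCounitDerivation f.ofConv →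
      IsCounitDerivation g.ofConv → ∀ a b, (f * g) (a * b) =
        (f * g) a * counit (R := K) b + g.ofConv a * f.ofConv b + f.ofConv a * g.ofConv b +
          counit (R := K) a * (f * g) b := by
    intro f g hf hg a b
    simp only [LinearMap.convMul_apply, map_comul_eq_leftSlice]
    rw [hf.leftSlice_mul, map_add, hg, hg, counit_leftSlice, counit_leftSlice]
    ring
  intro a b
  have h1 := h f g hf hg a b
  have h2 := h g f hg hf a b
  simp only [WithConv.ofConv_sub, LinearMap.sub_apply, h1, h2]
  ring

end CounitDerivation

/-! ## Pairings with enveloping algebras -/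

namespace UEA

variable {K : Type*} [Field K] {L : Type*} [LieRing L] [LieAlgebra K L]

/-- Since `L` generates `U(L)`, a subspace stable under left multiplication by `L` is a left ideal;
containing `1`, it is everything. -/
theorem induction_left {S : Submodule K (UniversalEnvelopingAlgebra K L)}
    (one : (1 : UniversalEnvelopingAlgebra K L) ∈ S)
    (mul : ∀ x, ∀ v ∈ S, UniversalEnvelopingAlgebra.ι K x * v ∈ S)
    (u : UniversalEnvelopingAlgebra K L) : u ∈ S := by
  have key : ∀ u : UniversalEnvelopingAlgebra K L, ∀ v ∈ S, u * v ∈ S := by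
    intro u
    have hu : u ∈ Algebra.adjoin K (Set.range (UniversalEnvelopingAlgebra.ι K (L := L))) :=
      adjoin_range_ι K L ▸ Algebra.mem_top
    induction hu using Algebra.adjoin_induction with
    | mem a ha => obtain ⟨x, rfl⟩ := ha; exact mul x
    | algebraMap r =>
      intro v hv
      rw [← Algebra.smul_def]; exact S.smul_mem _ hv
    | add a b _ _ ha hb => intro v hv; rw [add_mul]; exact S.add_mem (ha v hv) (hb v hv)
    | mul a b _ _ ha hb => intro v hv; rw [mul_assoc]; exact ha _ (hb v hv)
  simpa using key u 1 one

variable {A : Type*} [Ring A]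

section Bialgebra

variable [Bialgebra K A] (φ : L →ₗ⁅K⁆ WithConv (A →ₗ[K] K))

/-- The bilinear form on `A × U(L)` which extends a Lie homomorphism from `L` to the
convolution algebra of `A`. -/
def pairing : A →ₗ[K] UniversalEnvelopingAlgebra K L →ₗ[K] K :=
  ((WithConv.linearEquiv K (A →ₗ[K] K)).toLinearMap ∘ₗ
    (UniversalEnvelopingAlgebra.lift K φ).toLinearMap).flip

theorem pairing_apply (a : A) (u : UniversalEnvelopingAlgebra K L) :
    pairing φ a u = (UniversalEnvelopingAlgebra.lift K φ u).ofConv a := rfl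

theorem pairing_ι (a : A) (x : L) :
    pairing φ a (UniversalEnvelopingAlgebra.ι K x) = (φ x).ofConv a := by
  rw [pairing_apply, UniversalEnvelopingAlgebra.lift_ι_apply]

theorem pairing_one (a : A) : pairing φ a 1 = Coalgebra.counit (R := K) a := by
  rw [pairing_apply, map_one]; rfl

theorem pairing_mul (a : A) (u v : UniversalEnvelopingAlgebra K L) :
    pairing φ a (u * v) = LinearMap.mul' K K
      (TensorProduct.map ((pairing φ).flip u) ((pairing φ).flip v) (Coalgebra.comul a)) := by
  rw [pairing_apply, map_mul]; rfl

/-- Left multiplication by `x` is the transpose of a derivation of `A`. All later inductions peel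
off the first letter of a word in this way. -/
theorem pairing_ι_mul (a : A) (x : L) (v : UniversalEnvelopingAlgebra K L) :
    pairing φ a (UniversalEnvelopingAlgebra.ι K x * v) =
      pairing φ (leftSlice (φ x).ofConv a) v := by
  rw [pairing_mul, map_comul_eq_leftSlice, LinearMap.flip_apply]
  congr 2
  have : (pairing φ).flip (UniversalEnvelopingAlgebra.ι K x) = (φ x).ofConv := by
    ext a; rw [LinearMap.flip_apply, pairing_ι]
  rw [this]

variable (hφ : ∀ x, IsCounitDerivation (φ x).ofConv)
include hφ

theorem pairing_left_one (u : UniversalEnvelopingAlgebra K L) :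
    pairing φ 1 u = Coalgebra.counit (R := K) u := by
  refine induction_left (S := LinearMap.eqLocus (pairing φ 1) Coalgebra.counit) ?_ ?_ u
  · simp [pairing_one]
  · intro x v _
    have h : leftSlice (φ x).ofConv (1 : A) = 0 := by
      have h := (hφ x).leftSlice_mul 1 1
      simpa using h
    rw [LinearMap.mem_eqLocus, pairing_ι_mul, h, Bialgebra.counit_mul, counit_ι]
    simp

/-- For `u = x v`, the Leibniz rule for the slice by `x` on the side of `A` corresponds to `Δx = x ⊗
1 + 1 ⊗ x` on the side of `U(L)`. -/
theorem pairing_left_mul (u : UniversalEnvelopingAlgebra K L) (a b : A) :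
    pairing φ (a * b) u =
      LinearMap.mul' K K (TensorProduct.map (pairing φ a) (pairing φ b) (Coalgebra.comul u)) := by
  -- The identity is required for all `a` and `b` at once, because the induction step replaces them
  -- by their slices.
  let S : Submodule K (UniversalEnvelopingAlgebra K L) :=
    ⨅ a : A, ⨅ b : A, LinearMap.eqLocus (pairing φ (a * b))
      (LinearMap.mul' K K ∘ₗ TensorProduct.map (pairing φ a) (pairing φ b) ∘ₗ Coalgebra.comul)
  have hS : ∀ u, u ∈ S ↔ ∀ a b, pairing φ (a * b) u =
      LinearMap.mul' K K
        (TensorProduct.map (pairing φ a) (pairing φ b) (Coalgebra.comul u)) := by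
    intro u
    simp [S, Submodule.mem_iInf, LinearMap.mem_eqLocus]
  refine (hS u).1 (induction_left ?_ ?_ u) a b
  · rw [hS]
    intro a b
    simp [pairing_one, Algebra.TensorProduct.one_def]
  · intro x v hv
    rw [hS] at hv ⊢
    intro a b
    have h1 : ∀ t : UniversalEnvelopingAlgebra K L ⊗[K] UniversalEnvelopingAlgebra K L,
        LinearMap.mul' K K (TensorProduct.map (pairing φ a) (pairing φ b)
          ((UniversalEnvelopingAlgebra.ι K x ⊗ₜ 1 + 1 ⊗ₜ UniversalEnvelopingAlgebra.ι K x) * t)) =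
        LinearMap.mul' K K (TensorProduct.map (pairing φ (leftSlice (φ x).ofConv a))
          (pairing φ b) t) +
        LinearMap.mul' K K (TensorProduct.map (pairing φ a)
          (pairing φ (leftSlice (φ x).ofConv b)) t) := by
      intro t
      induction t using TensorProduct.induction_on with
      | zero => simp
      | add t t' ht ht' => simp only [mul_add, map_add, ht, ht']; abel
      | tmul p q =>
        simp only [add_mul, Algebra.TensorProduct.tmul_mul_tmul, one_mul, map_add,
          TensorProduct.map_tmul, LinearMap.mul'_apply, pairing_ι_mul]
    rw [pairing_ι_mul, (hφ x).leftSlice_mul, map_add, LinearMap.add_apply, hv, hv,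
      Bialgebra.comul_mul, comul_ι, h1]

end Bialgebra

variable [HopfAlgebra K A] (φ : L →ₗ⁅K⁆ WithConv (A →ₗ[K] K))

-- In the convolution algebra of forms on `A ⊗ U(L)`, precomposing the pairing with the antipode of
-- `A` gives a left inverse of it, and with the antipode of `U(L)` a right inverse. Hence the two
-- coincide.
open Coalgebra in
theorem pairing_antipode (hφ : ∀ x, IsCounitDerivation (φ x).ofConv) (a : A)
    (u : UniversalEnvelopingAlgebra K L) :
    pairing φ (HopfAlgebra.antipode K a) u = pairing φ a (HopfAlgebra.antipode K u) := by
  let β := pairing φ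
  have hl : ∀ (a b : A) (u : UniversalEnvelopingAlgebra K L) , β (a * b) u =
      ∑ i ∈ (ℛ K u).index, β a ((ℛ K u).left i) * β b ((ℛ K u).right i) := by
    intro a b u
    simp only [β]
    rw [pairing_left_mul φ hφ, ← (ℛ K u).eq]
    simp
  have hr : ∀ (a : A) (u v : UniversalEnvelopingAlgebra K L) , β a (u * v) =
      ∑ i ∈ (ℛ K a).index, β ((ℛ K a).left i) u * β ((ℛ K a).right i) v := by
    intro a u v
    simp only [β]
    rw [pairing_mul φ, ← (ℛ K a).eq]
    simp
  let b : WithConv (A ⊗[K] UniversalEnvelopingAlgebra K L →ₗ[K] K) :=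
    WithConv.toConv (TensorProduct.lift β)
  let b₁ : WithConv (A ⊗[K] UniversalEnvelopingAlgebra K L →ₗ[K] K) :=
    WithConv.toConv (TensorProduct.lift β ∘ₗ (HopfAlgebra.antipode K).rTensor _)
  let b₂ : WithConv (A ⊗[K] UniversalEnvelopingAlgebra K L →ₗ[K] K) :=
    WithConv.toConv (TensorProduct.lift β ∘ₗ (HopfAlgebra.antipode K).lTensor _)
  have h1 : b₁ * b = 1 := by
    refine WithConv.ext (TensorProduct.ext' fun a u => ?_)
    have h0 : (b₁ * b).ofConv (a ⊗ₜ u) = ∑ i ∈ (ℛ K a).index,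
        β (HopfAlgebra.antipode K ((ℛ K a).left i) * (ℛ K a).right i) u := by
      rw [((ℛ K a).tmul (ℛ K u)).convMul_apply]
      simp [Finset.sum_product, hl, b, b₁]
    rw [h0, ← LinearMap.sum_apply, ← map_sum, HopfAlgebra.sum_antipode_mul_eq_algebraMap_counit,
      Algebra.algebraMap_eq_smul_one, map_smul, LinearMap.smul_apply, pairing_left_one φ hφ]
    simp [mul_comm]
  have h2 : b * b₂ = 1 := by
    refine WithConv.ext (TensorProduct.ext' fun a u => ?_)
    have h0 : (b * b₂).ofConv (a ⊗ₜ u) = ∑ i ∈ (ℛ K u).index,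
        β a ((ℛ K u).left i * HopfAlgebra.antipode K ((ℛ K u).right i)) := by
      rw [((ℛ K a).tmul (ℛ K u)).convMul_apply]
      simp only [Coalgebra.Repr.tmul_index, Finset.sum_product, hr, b, b₂]
      rw [Finset.sum_comm]
      simp
    rw [h0, ← map_sum, HopfAlgebra.sum_mul_antipode_eq_algebraMap_counit,
      Algebra.algebraMap_eq_smul_one, map_smul, pairing_one φ]
    simp [mul_comm]
  have h := left_inv_eq_right_inv h1 h2
  exact congrArg (fun f => f.ofConv (a ⊗ₜ u)) h

theorem isHopfPairing_pairing (hφ : ∀ x, IsCounitDerivation (φ x).ofConv) :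
    ConnesMoscovici.IsHopfPairing K (pairing φ) where
  mul_left a b u := pairing_left_mul φ hφ u a b
  one_left := pairing_left_one φ hφ
  mul_right := pairing_mul φ
  one_right := pairing_one φ
  antipode := pairing_antipode φ hφ

end UEA

/-! ## Nondegeneracy of the pairing -/

namespace UEA

open Coalgebra

variable {K : Type*} [Field K] {L : Type*} [LieRing L] [LieAlgebra K L] {ι : Type*}

/-! ### Words in the enveloping algebra, modulo shorter words -/

/-- The product `Z_{i_1} ⋯ Z_{i_r}` in the enveloping algebra. -/
def word (Z : ι → L) (l : List ι) : UniversalEnvelopingAlgebra K L :=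
  (l.map fun i => UniversalEnvelopingAlgebra.ι K (Z i)).prod

@[simp] theorem word_nil (Z : ι → L) : word (K := K) Z [] = 1 := rfl

@[simp] theorem word_cons (Z : ι → L) (i : ι) (l : List ι) :
    word (K := K) Z (i :: l) = UniversalEnvelopingAlgebra.ι K (Z i) * word Z l := by
  simp only [word, List.map_cons, List.prod_cons]

theorem word_append (Z : ι → L) (l l' : List ι) :
    word (K := K) Z (l ++ l') = word Z l * word Z l' := by
  simp only [word, List.map_append, List.prod_append]

theorem ι_mul_mem_span {Z : ι → L} (hZ : Submodule.span K (Set.range Z) = ⊤) (x : L)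
    {S T : Submodule K (UniversalEnvelopingAlgebra K L)}
    (h : ∀ i, ∀ v ∈ S, UniversalEnvelopingAlgebra.ι K (Z i) * v ∈ T)
    {v : UniversalEnvelopingAlgebra K L} (hv : v ∈ S) :
    UniversalEnvelopingAlgebra.ι K x * v ∈ T := by
  have hx : x ∈ Submodule.span K (Set.range Z) := hZ ▸ Submodule.mem_top
  induction hx using Submodule.span_induction with
  | mem x hx => obtain ⟨i, rfl⟩ := hx; exact h i v hv
  | zero => rw [map_zero, zero_mul]; exact T.zero_mem
  | add x y _ _ hx hy => rw [map_add, add_mul]; exact T.add_mem hx hy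
  | smul c x _ hx => rw [map_smul, smul_mul_assoc]; exact T.smul_mem c hx

theorem span_word {Z : ι → L} (hZ : Submodule.span K (Set.range Z) = ⊤) :
    Submodule.span K (Set.range (word (K := K) Z)) = ⊤ := by
  rw [eq_top_iff]
  intro u _
  refine induction_left (S := Submodule.span K (Set.range (word (K := K) Z)))
    (Submodule.subset_span ⟨[], rfl⟩) (fun x v hv => ?_) u
  refine ι_mul_mem_span hZ x (fun i v hv => ?_) hv
  induction hv using Submodule.span_induction with
  | mem v hv =>
    obtain ⟨l, rfl⟩ := hv
    exact Submodule.subset_span ⟨i :: l, word_cons Z i l⟩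
  | zero => rw [mul_zero]; exact Submodule.zero_mem _
  | add x y _ _ hx hy => rw [mul_add]; exact Submodule.add_mem _ hx hy
  | smul c x _ hx => rw [mul_smul_comm]; exact Submodule.smul_mem _ c hx

/-- The span of the words of length less than `r`. -/
def shortWords (Z : ι → L) (r : ℕ) : Submodule K (UniversalEnvelopingAlgebra K L) :=
  Submodule.span K (word Z '' {l | l.length < r})

theorem ι_mul_mem_shortWords {Z : ι → L} (hZ : Submodule.span K (Set.range Z) = ⊤) (x : L)
    {r : ℕ} {v : UniversalEnvelopingAlgebra K L} (hv : v ∈ shortWords (K := K) Z r) :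
    UniversalEnvelopingAlgebra.ι K x * v ∈ shortWords (K := K) Z (r + 1) := by
  refine ι_mul_mem_span hZ x (fun i v hv => ?_) hv
  rw [shortWords] at hv
  induction hv using Submodule.span_induction with
  | mem v hv =>
    obtain ⟨l, hl, rfl⟩ := hv
    exact Submodule.subset_span ⟨i :: l, by simpa using hl, word_cons Z i l⟩
  | zero => rw [mul_zero]; exact Submodule.zero_mem _
  | add x y _ _ hx hy => rw [mul_add]; exact Submodule.add_mem _ hx hy
  | smul c x _ hx => rw [mul_smul_comm]; exact Submodule.smul_mem _ c hx

/-- Exchanging two neighbouring letters costs a word in which they are replaced by their bracket;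
expanded in the `Z_i`, it is a combination of words with one letter less. This is the easy half of
Poincaré–Birkhoff–Witt. -/
theorem word_sub_word_mem_shortWords {Z : ι → L} (hZ : Submodule.span K (Set.range Z) = ⊤)
    {l l' : List ι} (h : l.Perm l') :
    word (K := K) Z l - word Z l' ∈ shortWords (K := K) Z l.length := by
  induction h with
  | nil => simp
  | cons i h ih =>
    rw [word_cons, word_cons, ← mul_sub]
    exact ι_mul_mem_shortWords hZ _ ih
  | swap i j l =>
    have h : word (K := K) Z (j :: i :: l) - word Z (i :: j :: l) =
        UniversalEnvelopingAlgebra.ι K ⁅Z j, Z i⁆ * word Z l := by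
      simp only [word_cons, LieHom.map_lie, LieRing.of_associative_ring_bracket, sub_mul, mul_assoc]
    rw [h]
    exact ι_mul_mem_shortWords hZ _ (Submodule.subset_span ⟨l, by simp, rfl⟩)
  | trans h₁ h₂ ih₁ ih₂ =>
    rw [← h₁.length_eq] at ih₂
    rw [← sub_add_sub_cancel]
    exact Submodule.add_mem _ ih₁ ih₂

theorem eq_of_perm {Z : ι → L} (hZ : Submodule.span K (Set.range Z) = ⊤)
    (f : UniversalEnvelopingAlgebra K L →ₗ[K] K) {l l' : List ι} (h : l.Perm l')
    (hf : ∀ m : List ι, m.length < l.length → f (word Z m) = 0) :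
    f (word Z l) = f (word Z l') := by
  have hle : shortWords (K := K) Z l.length ≤ LinearMap.ker f := by
    rw [shortWords, Submodule.span_le]
    rintro _ ⟨m, hm, rfl⟩
    exact hf m hm
  have := hle (word_sub_word_mem_shortWords hZ h)
  rwa [LinearMap.mem_ker, map_sub, sub_eq_zero] at this

section

variable {A : Type*} [Ring A] [Bialgebra K A]

/-- Generators `δ_i` of `A`, in the augmentation ideal, and elements `Z_i` spanning
`L` and acting on `A` by derivations over the counit, with `⟨δ_i, Z_j⟩ = δ_{ij}`. -/
structure IsDualSystem [DecidableEq ι] (φ : L →ₗ⁅K⁆ WithConv (A →ₗ[K] K)) (δ : ι → A)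
    (Z : ι → L) : Prop where
  isCounitDerivation : ∀ x, IsCounitDerivation (φ x).ofConv
  apply_eq : ∀ i j, (φ (Z j)).ofConv (δ i) = if i = j then 1 else 0
  counit_eq : ∀ i, counit (R := K) (δ i) = 0
  adjoin_eq : Algebra.adjoin K (Set.range δ) = ⊤
  span_eq : Submodule.span K (Set.range Z) = ⊤

/-- `y` is a derivation and a coderivation of `A` for which `δ_i` has weight `w_i`. -/
structure IsWeightOperator (y : A →ₗ[K] A) (δ : ι → A) (w : ι → ℕ) : Prop where
  map_mul : ∀ a b, y (a * b) = y a * b + a * y b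
  comul_map : ∀ a, comul (R := K) (y a) = y.rTensor A (comul a) + y.lTensor A (comul a)
  counit_map : ∀ a, counit (R := K) (y a) = 0
  map_gen : ∀ i, y (δ i) = (w i : K) • δ i

end

/-! ### Triangularity of the pairing -/

section Commutative

variable {A : Type*} [CommRing A] [Bialgebra K A]

/-- Derivations over the counit lower the order with respect to the augmentation ideal by at
most one. -/
theorem leftSlice_mem_pow {f : A →ₗ[K] K} (hf : IsCounitDerivation f) (s : ℕ) {a : A}
    (ha : a ∈ RingHom.ker (Bialgebra.counitAlgHom K A) ^ (s + 1)) :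
    leftSlice f a ∈ RingHom.ker (Bialgebra.counitAlgHom K A) ^ s := by
  induction s generalizing a with
  | zero => simp
  | succ s ih =>
    rw [pow_succ] at ha
    refine Submodule.mul_induction_on ha (fun p hp q hq => ?_) (fun p q hp hq => ?_)
    · rw [hf.leftSlice_mul]
      refine Ideal.add_mem _ ?_ (Ideal.mul_mem_right _ _ hp)
      rw [pow_succ]
      exact Ideal.mul_mem_mul (ih hp) hq
    · rw [map_add]
      exact Ideal.add_mem _ hp hq

namespace IsDualSystem

variable [DecidableEq ι] {φ : L →ₗ⁅K⁆ WithConv (A →ₗ[K] K)} {δ : ι → A} {Z : ι → L}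
  (h : IsDualSystem φ δ Z)
include h

/-- Each letter lowers the order in the augmentation ideal by at most one. With fewer letters than
the order, an element of the ideal remains, and the counit kills it. -/
theorem pairing_eq_zero_of_mem_pow (l : List ι) {s : ℕ} (hs : l.length < s) {a : A}
    (ha : a ∈ RingHom.ker (Bialgebra.counitAlgHom K A) ^ s) : pairing φ a (word Z l) = 0 := by
  induction l generalizing s a with
  | nil =>
    rw [word_nil, pairing_one]
    exact Ideal.pow_le_self (by simp at hs; omega) ha
  | cons i l ih =>
    obtain ⟨s, rfl⟩ : ∃ t, s = t + 1 := ⟨s - 1, by simp at hs; omega⟩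
    rw [word_cons, pairing_ι_mul]
    exact ih (by simpa using hs) (leftSlice_mem_pow (h.isCounitDerivation _) s ha)

theorem prod_mem_pow (σ : Multiset ι) :
    (σ.map δ).prod ∈ RingHom.ker (Bialgebra.counitAlgHom K A) ^ Multiset.card σ := by
  induction σ using Multiset.induction_on with
  | empty => simp
  | cons i σ ih =>
    rw [Multiset.map_cons, Multiset.prod_cons, Multiset.card_cons, pow_succ']
    exact Ideal.mul_mem_mul (h.counit_eq i) ih

theorem leftSlice_sub_mem (k : ι) (i : ι) :
    leftSlice (φ (Z k)).ofConv (δ i) - (if i = k then 1 else 0) ∈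
      RingHom.ker (Bialgebra.counitAlgHom K A) := by
  rw [RingHom.mem_ker, map_sub]
  change counit (R := K) _ - _ = 0
  rw [counit_leftSlice, h.apply_eq]
  split_ifs <;> simp

/-- To leading order the slice by `Z_k` acts on monomials as `∂/∂δ_k`: by `leftSlice_sub_mem` it
sends `δ_i` to the Kronecker symbol modulo the augmentation ideal. -/
theorem leftSlice_prod_sub_mem (k : ι) (σ : Multiset ι) :
    leftSlice (φ (Z k)).ofConv (σ.map δ).prod - σ.count k • ((σ.erase k).map δ).prod ∈
      RingHom.ker (Bialgebra.counitAlgHom K A) ^ Multiset.card σ := by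
  induction σ using Multiset.induction_on with
  | empty => simp
  | cons i σ ih =>
    set I := RingHom.ker (Bialgebra.counitAlgHom K A)
    have h1 : (leftSlice (φ (Z k)).ofConv (δ i) - (if i = k then 1 else 0)) * (σ.map δ).prod ∈
        I ^ (Multiset.card σ + 1) := by
      rw [pow_succ']; exact Ideal.mul_mem_mul (h.leftSlice_sub_mem k i) (h.prod_mem_pow σ)
    have h2 : δ i * (leftSlice (φ (Z k)).ofConv (σ.map δ).prod -
        σ.count k • ((σ.erase k).map δ).prod) ∈ I ^ (Multiset.card σ + 1) := by
      rw [pow_succ']; exact Ideal.mul_mem_mul (h.counit_eq i) ih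
    -- This is the Leibniz rule for `∂/∂δ_k` on `δ_i` times the monomial of `σ`. If `i = k` does not
    -- occur in `σ`, the erased multiset is meaningless, but its coefficient is zero.
    have h3 : (i ::ₘ σ).count k • (((i ::ₘ σ).erase k).map δ).prod =
        (if i = k then 1 else 0) * (σ.map δ).prod +
          σ.count k • (δ i * ((σ.erase k).map δ).prod) := by
      by_cases hik : i = k
      · subst hik
        rw [Multiset.count_cons_self, Multiset.erase_cons_head, if_pos rfl, one_mul]
        by_cases hi : i ∈ σ
        · have : δ i * ((σ.erase i).map δ).prod = (σ.map δ).prod := by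
            conv_rhs => rw [← Multiset.cons_erase hi]
            rw [Multiset.map_cons, Multiset.prod_cons]
          rw [this, add_smul, one_smul, add_comm]
        · rw [Multiset.count_eq_zero_of_notMem hi]; simp
      · rw [Multiset.count_cons_of_ne (Ne.symm hik), Multiset.erase_cons_tail _ hik, if_neg hik,
          Multiset.map_cons, Multiset.prod_cons, zero_mul, zero_add]
    rw [Multiset.map_cons, Multiset.prod_cons, (h.isCounitDerivation _).leftSlice_mul, h3,
      Multiset.card_cons]
    convert Ideal.add_mem _ h1 h2 using 1
    rw [mul_sub, mul_smul_comm]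
    ring

/-- The error in `leftSlice_prod_sub_mem` has order `l.length + 1`, one too many for the remaining
word `l` to detect. -/
theorem pairing_prod_word_cons (k : ι) (l : List ι) (σ : Multiset ι)
    (hσ : Multiset.card σ = l.length + 1) :
    pairing φ (σ.map δ).prod (word Z (k :: l)) =
      (σ.count k : K) * pairing φ ((σ.erase k).map δ).prod (word Z l) := by
  have h0 := h.pairing_eq_zero_of_mem_pow l (by omega) (h.leftSlice_prod_sub_mem k σ)
  rw [map_sub, LinearMap.sub_apply, sub_eq_zero] at h0
  rw [word_cons, pairing_ι_mul, h0, map_nsmul, LinearMap.smul_apply, nsmul_eq_mul]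

theorem pairing_prod_word_of_lt (l : List ι) (σ : Multiset ι) (hσ : l.length < Multiset.card σ) :
    pairing φ (σ.map δ).prod (word Z l) = 0 :=
  h.pairing_eq_zero_of_mem_pow l hσ (h.prod_mem_pow σ)

theorem pairing_prod_word_of_ne (l : List ι) (σ : Multiset ι) (hσ : Multiset.card σ = l.length)
    (hne : σ ≠ l) : pairing φ (σ.map δ).prod (word Z l) = 0 := by
  induction l generalizing σ with
  | nil => exact absurd (Multiset.card_eq_zero.1 hσ) hne
  | cons k l ih =>
    rw [h.pairing_prod_word_cons k l σ hσ]
    by_cases hk : k ∈ σ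
    · rw [ih, mul_zero]
      · rw [Multiset.card_erase_of_mem hk, hσ]; rfl
      · rintro he
        apply hne
        rw [← Multiset.cons_erase hk, he]; rfl
    · rw [Multiset.count_eq_zero_of_notMem hk, Nat.cast_zero, zero_mul]

/-- The recursion produces the product of the factorials of the multiplicities of the letters, which
is where characteristic zero enters. -/
theorem pairing_prod_word_self [CharZero K] (l : List ι) :
    pairing φ ((l : Multiset ι).map δ).prod (word Z l) ≠ 0 := by
  induction l with
  | nil => simp [pairing_one]
  | cons k l ih =>
    rw [h.pairing_prod_word_cons k l _ (by simp)]
    refine mul_ne_zero ?_ ?_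
    · rw [Nat.cast_ne_zero]; simp
    · rw [← Multiset.cons_coe, Multiset.erase_cons_head]; exact ih

theorem exists_linearCombination (a : A) :
    ∃ c : Multiset ι →₀ K, a = Finsupp.linearCombination K (fun σ => (σ.map δ).prod) c := by
  have hs : a ∈ Submodule.span K (Set.range fun σ : Multiset ι => (σ.map δ).prod) := by
    have ha : a ∈ Algebra.adjoin K (Set.range δ) := h.adjoin_eq ▸ Algebra.mem_top
    rw [← Subalgebra.mem_toSubmodule, Algebra.adjoin_eq_span] at ha
    refine Submodule.span_mono ?_ ha
    intro x hx
    induction hx using Submonoid.closure_induction with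
    | mem x hx => obtain ⟨i, rfl⟩ := hx; exact ⟨{i}, by simp⟩
    | one => exact ⟨0, by simp⟩
    | mul x y _ _ hx hy =>
      obtain ⟨σ, rfl⟩ := hx
      obtain ⟨τ, rfl⟩ := hy
      exact ⟨σ + τ, by simp⟩
  obtain ⟨c, hc⟩ := (Finsupp.mem_span_range_iff_exists_finsupp).1 hs
  exact ⟨c, hc.symm⟩

/-- A monomial of smallest degree in `a` is detected by its own word: monomials of higher degree and
the other ones of the same degree pair to zero with it. An arbitrary expression of `a` in monomials
will do, so their independence need not be known. -/
theorem pairing_injective [CharZero K] : Function.Injective (pairing φ) := by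
  rw [injective_iff_map_eq_zero]
  intro a ha
  obtain ⟨c, rfl⟩ := h.exists_linearCombination a
  by_contra hne
  have hc : c.support.Nonempty := by
    rw [Finset.nonempty_iff_ne_empty]
    intro h0
    rw [Finsupp.support_eq_empty] at h0
    exact hne (by rw [h0, map_zero])
  obtain ⟨σ, hσ, hmin⟩ := c.support.exists_min_image Multiset.card hc
  have h1 := LinearMap.congr_fun ha (word Z σ.toList)
  rw [Finsupp.linearCombination_apply, Finsupp.sum, map_sum, LinearMap.sum_apply,
    Finset.sum_eq_single σ] at h1
  · rw [map_smul, LinearMap.smul_apply, smul_eq_mul, LinearMap.zero_apply] at h1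
    have h2 := h.pairing_prod_word_self σ.toList
    rw [Multiset.coe_toList] at h2
    exact (mul_ne_zero (Finsupp.mem_support_iff.1 hσ) h2) h1
  · intro τ hτ hτσ
    rw [map_smul, LinearMap.smul_apply]
    rcases (hmin τ hτ).lt_or_eq with hlt | heq
    · rw [h.pairing_prod_word_of_lt _ _ (by simpa using hlt), smul_zero]
    · rw [h.pairing_prod_word_of_ne _ _ (by simpa using heq.symm) (by simpa using hτσ), smul_zero]
  · intro h0; exact absurd hσ h0

end IsDualSystem

/-! ### Orthogonality of weights, and surjectivity -/

theorem IsWeightOperator.map_prod {δ : ι → A} {y : A →ₗ[K] A} {w : ι → ℕ}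
    (hy : IsWeightOperator y δ w) (σ : Multiset ι) :
    y (σ.map δ).prod = ((σ.map w).sum : K) • (σ.map δ).prod := by
  induction σ using Multiset.induction_on with
  | empty =>
    have := hy.map_mul 1 1
    simp at this
    simpa using this
  | cons i σ ih =>
    simp only [Multiset.map_cons, Multiset.prod_cons, Multiset.sum_cons]
    rw [hy.map_mul, ih, hy.map_gen]
    push_cast
    rw [add_smul, smul_mul_assoc, mul_smul_comm]

namespace IsDualSystem

variable [DecidableEq ι] {φ : L →ₗ⁅K⁆ WithConv (A →ₗ[K] K)} {δ : ι → A} {Z : ι → L}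
  (h : IsDualSystem φ δ Z) {y : A →ₗ[K] A} {w : ι → ℕ} (hy : IsWeightOperator y δ w)
include h hy

/-- Both sides are derivations over the counit, the left one because the counit vanishes on the
image of `y`. So it is enough to compare them on the generators. -/
theorem apply_weight (j : ι) (a : A) :
    (φ (Z j)).ofConv (y a) = (w j : K) * (φ (Z j)).ofConv a := by
  have hd := h.isCounitDerivation (Z j)
  have h1 : IsCounitDerivation ((φ (Z j)).ofConv ∘ₗ y) := by
    intro a b
    simp only [LinearMap.comp_apply]
    rw [hy.map_mul, map_add, hd, hd, hy.counit_map, hy.counit_map]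
    ring
  have h2 : IsCounitDerivation ((w j : K) • (φ (Z j)).ofConv) := by
    intro a b
    simp only [LinearMap.smul_apply, smul_eq_mul]
    rw [hd]
    ring
  refine LinearMap.congr_fun (h1.ext_of_adjoin h2 h.adjoin_eq ?_) a
  rintro _ ⟨i, rfl⟩
  simp only [LinearMap.comp_apply, LinearMap.smul_apply, hy.map_gen, map_smul, h.apply_eq,
    smul_eq_mul]
  split_ifs with hij
  · rw [hij]
  · simp

/-- As `y` is a coderivation, slicing `y a` by the first letter gives one term where `y` meets that
letter and contributes its weight, and one where `y` acts on the slice, to which induction applies.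
-/
theorem pairing_weight (l : List ι) (a : A) :
    pairing φ (y a) (word Z l) = ((l.map w).sum : K) * pairing φ a (word Z l) := by
  induction l generalizing a with
  | nil => simp [pairing_one, hy.counit_map]
  | cons k l ih =>
    have key : ∀ t : A ⊗[K] A, TensorProduct.lid K A ((φ (Z k)).ofConv.rTensor A
        (y.rTensor A t + y.lTensor A t)) =
        (w k : K) • TensorProduct.lid K A ((φ (Z k)).ofConv.rTensor A t) +
          y (TensorProduct.lid K A ((φ (Z k)).ofConv.rTensor A t)) := by
      intro t
      induction t using TensorProduct.induction_on with
      | zero => simp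
      | add t t' ht ht' =>
        simp only [map_add, smul_add] at ht ht' ⊢
        rw [add_add_add_comm, ht, ht']; abel
      | tmul p q => simp [h.apply_weight hy, mul_smul]
    have h1 : leftSlice (φ (Z k)).ofConv (y a) =
        (w k : K) • leftSlice (φ (Z k)).ofConv a + y (leftSlice (φ (Z k)).ofConv a) := by
      have := key (comul a)
      rw [← hy.comul_map] at this
      simpa [leftSlice] using this
    rw [word_cons, pairing_ι_mul, pairing_ι_mul, h1, map_add, LinearMap.add_apply, ih, map_smul,
      LinearMap.smul_apply, List.map_cons, List.sum_cons, smul_eq_mul, Nat.cast_add, add_mul]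

theorem pairing_eq_zero_of_weight_ne [CharZero K] (σ : Multiset ι) (l : List ι)
    (hne : (σ.map w).sum ≠ (l.map w).sum) : pairing φ (σ.map δ).prod (word Z l) = 0 := by
  have h1 := h.pairing_weight hy l (σ.map δ).prod
  rw [hy.map_prod, map_smul, LinearMap.smul_apply, smul_eq_mul, ← sub_eq_zero, ← sub_mul] at h1
  exact (mul_eq_zero.1 h1).resolve_left (sub_ne_zero.2 (by exact_mod_cast hne))

theorem exists_weight_bound [CharZero K] (a : A) :
    ∃ M : ℕ, ∀ l : List ι, M ≤ (l.map w).sum → pairing φ a (word Z l) = 0 := by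
  obtain ⟨c, rfl⟩ := h.exists_linearCombination a
  refine ⟨c.support.sup (fun σ => (σ.map w).sum) + 1, fun l hl => ?_⟩
  rw [Finsupp.linearCombination_apply, Finsupp.sum, map_sum, LinearMap.sum_apply]
  refine Finset.sum_eq_zero fun σ hσ => ?_
  have hle : (σ.map w).sum ≤ c.support.sup (fun σ => (σ.map w).sum) :=
    Finset.le_sup (f := fun σ : Multiset ι => (σ.map w).sum) hσ
  rw [map_smul, LinearMap.smul_apply, h.pairing_eq_zero_of_weight_ne hy _ _ (by omega), smul_zero]

/-- A linear form vanishing in large weights agrees on short words with an element of `A`. -/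
theorem exists_agree_of_length_lt [CharZero K] [Finite ι]
    (f : UniversalEnvelopingAlgebra K L →ₗ[K] K) (M : ℕ)
    (hf : ∀ l : List ι, M ≤ (l.map w).sum → f (word Z l) = 0) (r : ℕ) :
    ∃ a : A, (∀ l : List ι, M ≤ (l.map w).sum → pairing φ a (word Z l) = 0) ∧
      ∀ l : List ι, l.length < r → f (word Z l) = pairing φ a (word Z l) := by
  have := Fintype.ofFinite ι
  induction r with
  | zero => exact ⟨0, by simp, by simp⟩
  | succ r ih =>
    obtain ⟨a, ha, hfa⟩ := ih
    set g := f - pairing φ a with hg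
    have hg0 : ∀ l : List ι, l.length < r → g (word Z l) = 0 := fun l hl => by
      rw [hg, LinearMap.sub_apply, hfa l hl, sub_self]
    have hgM : ∀ l : List ι, M ≤ (l.map w).sum → g (word Z l) = 0 := fun l hl => by
      rw [hg, LinearMap.sub_apply, hf l hl, ha l hl, sub_self]
    -- In length `r` the pairing is diagonal on multisets, so these coefficients are forced; the
    -- denominator is nonzero by `pairing_prod_word_self`.
    let c : Multiset ι → K := fun σ =>
      g (word Z σ.toList) / pairing φ (σ.map δ).prod (word Z σ.toList)
    let b : A := ∑ σ : Sym ι r, c σ • ((σ : Multiset ι).map δ).prod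
    have hb : ∀ l, pairing φ b (word Z l) = ∑ σ : Sym ι r,
        c σ * pairing φ ((σ : Multiset ι).map δ).prod (word Z l) := by
      intro l
      simp only [b, map_sum, LinearMap.sum_apply, map_smul, LinearMap.smul_apply, smul_eq_mul]
    refine ⟨a + b, fun l hl => ?_, fun l hl => ?_⟩
    · rw [map_add, LinearMap.add_apply, ha l hl, zero_add, hb]
      refine Finset.sum_eq_zero fun σ _ => ?_
      -- The correction stays orthogonal to weights at least `M`: a monomial of such a weight has
      -- coefficient zero because `g` vanishes there, and a monomial of another weight is orthogonal
      -- to `l`.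
      by_cases hσ : (((σ : Multiset ι)).map w).sum = (l.map w).sum
      · have : g (word Z (σ : Multiset ι).toList) = 0 := by
          apply hgM
          rw [← Multiset.sum_coe, ← Multiset.map_coe, Multiset.coe_toList, hσ]
          exact hl
        simp only [c, this, zero_div, zero_mul]
      · rw [h.pairing_eq_zero_of_weight_ne hy _ _ hσ, mul_zero]
    · suffices hs : g (word Z l) = pairing φ b (word Z l) by
        rw [map_add, LinearMap.add_apply, ← hs, hg, LinearMap.sub_apply]; ring
      rw [hb]
      rcases (Nat.lt_succ_iff.1 hl).lt_or_eq with hlt | heq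
      · rw [hg0 l hlt, eq_comm]
        refine Finset.sum_eq_zero fun σ _ => ?_
        rw [h.pairing_prod_word_of_lt l _ (by rw [Sym.card_coe]; exact hlt), mul_zero]
      · let σ : Sym ι r := ⟨l, by simpa using heq⟩
        rw [Finset.sum_eq_single σ]
        · have hp : l.Perm (σ : Multiset ι).toList := by
            rw [← Multiset.coe_eq_coe, Multiset.coe_toList]; rfl
          have h1 := h.pairing_prod_word_self (σ : Multiset ι).toList
          rw [Multiset.coe_toList] at h1
          -- Both `g` and the pairing with a monomial of degree `r` vanish on shorter words, so on
          -- words of length `r` they depend only on the multiset of letters, and `l` may be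
          -- replaced by the chosen ordering.
          rw [eq_of_perm h.span_eq g hp (fun m hm => hg0 m (by omega)),
            eq_of_perm h.span_eq (pairing φ ((σ : Multiset ι).map δ).prod) hp
              (fun m hm => h.pairing_prod_word_of_lt m _ (by rw [Sym.card_coe]; omega)),
            div_mul_cancel₀ _ h1]
        · intro τ _ hτ
          rw [h.pairing_prod_word_of_ne l _ (by rw [Sym.card_coe, heq]), mul_zero]
          intro he
          exact hτ (Subtype.ext he)
        · intro h0; exact absurd (Finset.mem_univ _) h0

/-- Agreement on words of length less than `M` suffices: positive weights make every longer word
have weight at least `M`, where both forms vanish. -/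
theorem exists_pairing_eq [CharZero K] [Finite ι] (hw : ∀ i, 0 < w i)
    (f : UniversalEnvelopingAlgebra K L →ₗ[K] K) (M : ℕ)
    (hf : ∀ l : List ι, M ≤ (l.map w).sum → f (word Z l) = 0) : ∃ a : A, pairing φ a = f := by
  obtain ⟨a, ha, hfa⟩ := h.exists_agree_of_length_lt hy f M hf M
  refine ⟨a, LinearMap.ext_on (span_word h.span_eq) ?_⟩
  rintro _ ⟨l, rfl⟩
  by_cases hl : M ≤ (l.map w).sum
  · rw [hf l hl, ha l hl]
  · have hlen : l.length ≤ (l.map w).sum := by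
      have := List.length_le_sum_of_one_le (l.map w) (by
        intro i hi
        obtain ⟨j, _, rfl⟩ := List.mem_map.1 hi
        exact hw j)
      simpa using this
    exact (hfa l (by omega)).symm

end IsDualSystem

end Commutative

namespace IsDualSystem

variable [DecidableEq ι] {A : Type*} [Ring A] [Bialgebra K A]
  {φ : L →ₗ⁅K⁆ WithConv (A →ₗ[K] K)} {δ : ι → A} {Z : ι → L}

theorem injective_of_comm [CharZero K] (hc : ∀ a b : A, a * b = b * a)
    (h : IsDualSystem φ δ Z) : Function.Injective (pairing φ) := by
  -- The commutative structure extends the given ring, so the bialgebra structure and the pairing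
  -- stay the same.
  let _ : CommRing A := { toRing := inferInstance, mul_comm := hc }
  exact pairing_injective h

theorem exists_pairing_eq_iff [CharZero K] [Finite ι] (hc : ∀ a b : A, a * b = b * a)
    (h : IsDualSystem φ δ Z) {y : A →ₗ[K] A} {w : ι → ℕ} (hy : IsWeightOperator y δ w)
    (hw : ∀ i, 0 < w i) (f : UniversalEnvelopingAlgebra K L →ₗ[K] K) :
    (∃ a : A, pairing φ a = f) ↔
      ∃ M : ℕ, ∀ l : List ι, M ≤ (l.map w).sum → f (word Z l) = 0 := by
  let _ : CommRing A := { toRing := inferInstance, mul_comm := hc }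
  constructor
  · rintro ⟨a, rfl⟩
    exact exists_weight_bound h hy a
  · rintro ⟨M, hM⟩
    exact exists_pairing_eq h hy hw f M hM

end IsDualSystem

end UEA

namespace ConnesMoscovici

open Coalgebra

variable (K : Type*) [Field K]

/-! ## The linear part of an element of `H` -/

namespace LieH

/-- The action of `Y` on `K × ⨁ K δ_n`. -/
def actY : Module.End K (K × (ℕ+ →₀ K)) := LinearMap.inr K K _ ∘ₗ weight K ∘ₗ LinearMap.snd K K _

/-- The action of `X` on `K × ⨁ K δ_n`. -/
def actX : Module.End K (K × (ℕ+ →₀ K)) := LinearMap.inr K K _ ∘ₗ shift K ∘ₗ LinearMap.snd K K _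

/-- The action of `δ_n` on `K × ⨁ K δ_n`. -/
def actδ (n : ℕ+) : Module.End K (K × (ℕ+ →₀ K)) :=
  LinearMap.inr K K _ ∘ₗ LinearMap.toSpanSingleton K _ (Finsupp.single n 1) ∘ₗ LinearMap.fst K K _

@[simp] theorem actY_apply (v : K × (ℕ+ →₀ K)) : actY K v = (0, weight K v.2) := rfl
@[simp] theorem actX_apply (v : K × (ℕ+ →₀ K)) : actX K v = (0, shift K v.2) := rfl
@[simp] theorem actδ_apply (n : ℕ+) (v : K × (ℕ+ →₀ K)) :
    actδ K n v = (0, v.1 • Finsupp.single n 1) := rfl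

@[simp] theorem weight_single (n : ℕ+) (c : K) :
    weight K (Finsupp.single n c) = ((n : ℕ) : K) • Finsupp.single n c := by
  simp [weight, mul_comm]

@[simp] theorem shift_single (n : ℕ+) (c : K) :
    shift K (Finsupp.single n c) = Finsupp.single (n + 1) c := by
  simp [shift]

end LieH

namespace H

/-- The representation of `H` on `K × ⨁ K δ_n`, the quotient of the polynomials in the `δ_n` by
the square of the augmentation ideal. -/
def rep : H K →ₐ[K] Module.End K (K × (ℕ+ →₀ K)) :=
  lift (LieH.toAssoc K (LieH.actY K) (LieH.actX K) (LieH.actδ K)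
    (LinearMap.ext fun v => by simp [LieH.weight_shift])
    (fun n => LinearMap.ext fun v => by simp)
    (fun n => LinearMap.ext fun v => by simp)
    (fun n m => LinearMap.ext fun v => by simp))

@[simp] theorem rep_Y : rep K (Y K) = LieH.actY K := by
  refine (lift_ι _ _).trans ?_; rw [LieH.toAssoc_apply]; simp [LieH.Y]

@[simp] theorem rep_X : rep K (X K) = LieH.actX K := by
  refine (lift_ι _ _).trans ?_; rw [LieH.toAssoc_apply]; simp [LieH.X]

@[simp] theorem rep_δ (n : ℕ+) : rep K (δ K n) = LieH.actδ K n := by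
  refine (lift_ι _ _).trans ?_; rw [LieH.toAssoc_apply]; simp [LieH.δ]

/-- The vectors with first component zero form a subrepresentation whose quotient is the trivial
module, on which `H` acts by the counit. -/
theorem rep_fst (a : H K) (v : K × (ℕ+ →₀ K)) :
    (rep K a v).1 = counit (R := K) a * v.1 := by
  have ha : a ∈ Algebra.adjoin K ({Y K, X K, δ K 1} : Set (H K)) :=
    adjoin_eq_top K ▸ Algebra.mem_top
  induction ha using Algebra.adjoin_induction generalizing v with
  | mem a ha =>
    rcases ha with rfl | rfl | rfl
    · simp [counit_Y]
    · simp [counit_X]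
    · simp [counit_δ]
  | algebraMap r => simp [Algebra.algebraMap_eq_smul_one]
  | add a b _ _ ha hb => simp [ha, hb, add_mul]
  | mul a b _ _ ha hb => simp [ha, hb, mul_assoc]

/-- The linear part of an element of `H`. -/
def linearPart : H K →ₗ[K] (ℕ+ →₀ K) :=
  LinearMap.snd K K _ ∘ₗ LinearMap.applyₗ (1, 0) ∘ₗ (rep K).toLinearMap

theorem linearPart_apply (a : H K) : linearPart K a = (rep K a (1, 0)).2 := rfl

theorem rep_one_zero (a : H K) : rep K a (1, 0) = (counit (R := K) a, linearPart K a) := by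
  ext1
  · rw [rep_fst, mul_one]
  · rfl

theorem linearPart_X_mul (a : H K) :
    linearPart K (X K * a) = LieH.shift K (linearPart K a) := by
  simp [linearPart_apply]

theorem linearPart_Y_mul (a : H K) :
    linearPart K (Y K * a) = LieH.weight K (linearPart K a) := by
  simp [linearPart_apply]

theorem linearPart_δ_mul (n : ℕ+) (a : H K) :
    linearPart K (δ K n * a) = counit (R := K) a • Finsupp.single n 1 := by
  rw [linearPart_apply, map_mul, Module.End.mul_apply, rep_one_zero, rep_δ, LieH.actδ_apply]

/-- `X` and `Y` act by derivations of the polynomials in the `δ_n`, so they kill the constant `(1,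
0)`. -/
theorem linearPart_mul_X (a : H K) : linearPart K (a * X K) = 0 := by
  simp [linearPart_apply, ← Prod.zero_eq_mk]

theorem linearPart_mul_Y (a : H K) : linearPart K (a * Y K) = 0 := by
  simp [linearPart_apply, ← Prod.zero_eq_mk]

@[simp] theorem linearPart_δ (n : ℕ+) : linearPart K (δ K n) = Finsupp.single n 1 := by
  have := linearPart_δ_mul K n 1
  simpa using this

/-- The part of a tensor which is linear in both factors. -/
def linearPart₂ : H K ⊗[K] H K →ₗ[K] (ℕ+ →₀ K) ⊗[K] (ℕ+ →₀ K) :=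
  TensorProduct.map (linearPart K) (linearPart K)

/-- The summand `δ_1 ⊗ Y` of `ΔX` yields the last term: multiplication by `δ_1` leaves only the
counit of the first factor, and `Y` acts on the second by the weight. -/
theorem linearPart₂_ΔX_mul (t : H K ⊗[K] H K) :
    linearPart₂ K (ΔX K * t) = (LieH.shift K).rTensor _ (linearPart₂ K t) +
      (LieH.shift K).lTensor _ (linearPart₂ K t) +
      Finsupp.single 1 1 ⊗ₜ LieH.weight K (linearPart K
        (TensorProduct.lid K (H K) ((counit (R := K)).rTensor (H K) t))) := by
  induction t using TensorProduct.induction_on with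
  | zero => simp
  | add t t' ht ht' =>
    simp only [mul_add, map_add, ht, ht', TensorProduct.tmul_add]
    abel
  | tmul a b =>
    simp only [ΔX, add_mul, Algebra.TensorProduct.tmul_mul_tmul, one_mul, map_add, linearPart₂,
      TensorProduct.map_tmul, linearPart_X_mul, linearPart_δ_mul, linearPart_Y_mul,
      LinearMap.rTensor_tmul, LinearMap.lTensor_tmul, TensorProduct.lid_tmul, map_smul,
      TensorProduct.smul_tmul]

theorem linearPart₂_mul_ΔX (t : H K ⊗[K] H K) : linearPart₂ K (t * ΔX K) = 0 := by
  induction t using TensorProduct.induction_on with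
  | zero => simp
  | add t t' ht ht' => rw [add_mul, map_add, ht, ht', add_zero]
  | tmul a b => simp [ΔX, mul_add, linearPart₂, linearPart_mul_X, linearPart_mul_Y]

/-- The basis vector `e_k` for `k ≥ 1`, and `0` for `k = 0`. -/
def basisVec (k : ℕ) : ℕ+ →₀ K := if h : 0 < k then Finsupp.single ⟨k, h⟩ 1 else 0

theorem basisVec_zero : basisVec K 0 = 0 := rfl

theorem basisVec_coe (k : ℕ+) : basisVec K k = Finsupp.single k 1 := by
  rw [basisVec, dif_pos k.pos]
  rfl

theorem shift_basisVec_succ (k : ℕ) :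
    LieH.shift K (basisVec K (k + 1)) = basisVec K (k + 1 + 1) := by
  have h := LieH.shift_single K k.succPNat 1
  rw [← basisVec_coe, ← basisVec_coe] at h
  exact h

/-- Only `ΔX · Δδ_j` contributes to `[ΔX, Δδ_j]`. The two shifts give Pascal's rule for the
coefficients, and the term from `δ_1 ⊗ Y` supplies the entry `e_1 ⊗ e_j`, which no shift reaches. -/
theorem linearPart₂_Δδ (j : ℕ+) : linearPart₂ K (Δδ K j) =
    ∑ p ∈ Finset.HasAntidiagonal.antidiagonal (j : ℕ),
      ((j : ℕ).choose (p.1 + 1) : K) • (basisVec K p.1 ⊗ₜ[K] basisVec K p.2) := by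
  induction j using PNat.recOn with
  | one =>
    rw [Δδ, dseq_one]
    have h1 : linearPart K 1 = 0 := by simp [linearPart_apply]
    simp [linearPart₂, h1, Finset.Nat.antidiagonal_succ, basisVec_zero]
  | succ j ih =>
    have h1 : linearPart K (TensorProduct.lid K (H K)
        ((counit (R := K)).rTensor (H K) (Δδ K j))) = basisVec K j := by
      have := rTensor_counit_comul (R := K) (δ K j)
      rw [show comul (R := K) (δ K j) = Δδ K j from comulHom_δ K j] at this
      rw [this, TensorProduct.lid_tmul, one_smul, linearPart_δ, basisVec_coe]
    have h2 : LieH.weight K (basisVec K j) = ((j : ℕ) : K) • basisVec K j := by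
      rw [basisVec_coe, LieH.weight_single]
    have h0 : linearPart₂ K (Δδ K (j + 1)) = linearPart₂ K (ΔX K * Δδ K j) := by
      rw [sub_eq_iff_eq_add.1 (ΔX_Δδ K j), map_add, linearPart₂_mul_ΔX, add_zero]
    rw [h0, linearPart₂_ΔX_mul, h1, h2, ih, PNat.add_coe, PNat.one_coe]
    generalize (j : ℕ) = j
    have h3 : ∑ p ∈ Finset.HasAntidiagonal.antidiagonal (j + 1),
        ((j + 1).choose (p.1 + 1) : K) • (basisVec K p.1 ⊗ₜ[K] basisVec K p.2) =
        ∑ p ∈ Finset.HasAntidiagonal.antidiagonal j,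
          (j.choose (p.1 + 1) : K) • (basisVec K (p.1 + 1) ⊗ₜ[K] basisVec K p.2) +
        ∑ p ∈ Finset.HasAntidiagonal.antidiagonal j,
          (j.choose (p.1 + 1) : K) • (basisVec K p.1 ⊗ₜ[K] basisVec K (p.2 + 1)) := by
      simp only [Nat.choose_succ_succ' j, Nat.cast_add, add_smul, Finset.sum_add_distrib]
      congr 1
      · rw [Finset.Nat.antidiagonal_succ]
        simp [basisVec_zero]
      · rw [Finset.Nat.antidiagonal_succ']
        simp [basisVec_zero]
    -- For `p.1 = 0` the left side has `C(j, 1) e_1 ⊗ e_j`, whereas the shift of `basisVec K 0` is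
    -- `0`. The extra term makes up the difference.
    have h4 : ∑ p ∈ Finset.HasAntidiagonal.antidiagonal j,
          (j.choose (p.1 + 1) : K) • (basisVec K (p.1 + 1) ⊗ₜ[K] basisVec K p.2) =
        ∑ p ∈ Finset.HasAntidiagonal.antidiagonal j,
          (j.choose (p.1 + 1) : K) • (LieH.shift K (basisVec K p.1) ⊗ₜ[K] basisVec K p.2) +
        (j : K) • (basisVec K 1 ⊗ₜ[K] basisVec K j) := by
      have h5 : (j : K) • (basisVec K 1 ⊗ₜ[K] basisVec K j) =
          ∑ p ∈ Finset.HasAntidiagonal.antidiagonal j,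
            if p.1 = 0 then (j : K) • (basisVec K 1 ⊗ₜ[K] basisVec K j) else 0 := by
        rw [Finset.sum_eq_single (0, j)]
        · simp
        · rintro ⟨k, l⟩ hp hne
          refine if_neg fun hk => hne ?_
          simp only at hk
          rw [Finset.HasAntidiagonal.mem_antidiagonal, hk, zero_add] at hp
          exact Prod.ext hk hp
        · simp
      rw [h5, ← Finset.sum_add_distrib]
      refine Finset.sum_congr rfl ?_
      rintro ⟨_ | k, l⟩ hp
      · simp only [Finset.HasAntidiagonal.mem_antidiagonal, zero_add] at hp
        simp [basisVec_zero, hp]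
      · rw [shift_basisVec_succ, if_neg (Nat.succ_ne_zero k), add_zero]
    -- At `p.2 = 0` the shift of `basisVec K 0` is again not `basisVec K 1`, but here the
    -- coefficient `C(j, j+1)` is zero.
    have h5 : ∑ p ∈ Finset.HasAntidiagonal.antidiagonal j,
          (j.choose (p.1 + 1) : K) • (basisVec K p.1 ⊗ₜ[K] basisVec K (p.2 + 1)) =
        ∑ p ∈ Finset.HasAntidiagonal.antidiagonal j,
          (j.choose (p.1 + 1) : K) • (basisVec K p.1 ⊗ₜ[K] LieH.shift K (basisVec K p.2)) := by
      refine Finset.sum_congr rfl ?_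
      rintro ⟨k, _ | l⟩ hp
      · simp only [Finset.HasAntidiagonal.mem_antidiagonal, add_zero] at hp
        rw [← hp, Nat.choose_succ_self, Nat.cast_zero, zero_smul, zero_smul]
      · rw [shift_basisVec_succ]
    rw [h3, h4, h5, TensorProduct.tmul_smul, ← PNat.one_coe, basisVec_coe, PNat.one_coe]
    simp only [map_sum, map_smul, LinearMap.rTensor_tmul, LinearMap.lTensor_tmul]
    abel

end H

namespace Hn

variable {K} in
theorem rep_zero_snd {n : ℕ} {a : H K} (ha : a ∈ Hn K n) (v : ℕ+ →₀ K) :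
    H.rep K a (0, v) = (0, counit (R := K) a • v) := by
  induction ha using Algebra.adjoin_induction generalizing v with
  | mem a ha => obtain ⟨k, _, rfl⟩ := ha; simp [H.counit_δ]
  | algebraMap r => simp [Algebra.algebraMap_eq_smul_one]
  | add a b _ _ ha hb => simp [ha, hb, add_smul]
  | mul a b _ _ ha hb => simp [ha, hb, mul_smul]

variable {K} in
-- This needs the left factor in `H_n`: it then acts on the linear terms by its counit, whereas `X`
-- would shift them.
theorem linearPart_mul {n : ℕ} {a : H K} (ha : a ∈ Hn K n) (b : H K) :
    H.linearPart K (a * b) =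
      counit (R := K) b • H.linearPart K a + counit (R := K) a • H.linearPart K b := by
  have h : ((counit (R := K) b, H.linearPart K b) : K × (ℕ+ →₀ K)) =
      counit (R := K) b • (1, 0) + (0, H.linearPart K b) := by simp
  rw [H.linearPart_apply, map_mul, Module.End.mul_apply, H.rep_one_zero, h, map_add, map_smul,
    rep_zero_snd ha, H.rep_one_zero]
  rfl

end Hn

/-! ## The coordinates of a vector field -/

namespace A1

variable {K}

/-- The difference of the two sides is a derivation killing `x`. By `X_pow_dvd_derivation` its
values are divisible by every power of `x`, so no continuity has to be assumed. -/
theorem derivation_apply (D : Derivation K K⟦X⟧ K⟦X⟧) (g : K⟦X⟧) :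
    D g = D PowerSeries.X * PowerSeries.derivative K g := by
  set E : Derivation K K⟦X⟧ K⟦X⟧ := D - D PowerSeries.X • PowerSeries.derivative K with hE
  have h0 : E PowerSeries.X = 0 := by
    rw [hE, Derivation.sub_apply, Derivation.smul_apply, PowerSeries.derivative_X, smul_eq_mul,
      mul_one, sub_self]
  have h1 : E g = 0 := by
    ext m
    have := X_pow_dvd_derivation E (m + 1) (by rw [h0]; exact dvd_zero _) g
    rw [PowerSeries.X_pow_dvd_iff] at this
    rw [this m (Nat.lt_succ_self m), map_zero]
  rw [hE, Derivation.sub_apply, sub_eq_zero] at h1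
  exact h1

variable (K) in
/-- The coordinate `(k+1)! f_{k+1}` of the vector field `f(x) ∂/∂x`. -/
def coord (k : ℕ) : A1 K →ₗ[K] K where
  toFun D := ((k + 1).factorial : K) * PowerSeries.coeff (k + 1) (D.1 PowerSeries.X)
  map_add' D E := by
    change _ * PowerSeries.coeff (k + 1) (D.1 PowerSeries.X + E.1 PowerSeries.X) = _
    rw [map_add, mul_add]
  map_smul' c D := by
    change _ * PowerSeries.coeff (k + 1) (c • D.1 PowerSeries.X) = _
    rw [map_smul, smul_eq_mul, mul_left_comm]
    rfl

theorem coord_apply (k : ℕ) (D : A1 K) :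
    coord K k D = ((k + 1).factorial : K) * PowerSeries.coeff (k + 1) (D.1 PowerSeries.X) := rfl

theorem coeff_eq_zero (D : A1 K) {k : ℕ} (hk : k < 2) :
    PowerSeries.coeff k (D.1 PowerSeries.X) = 0 :=
  PowerSeries.X_pow_dvd_iff.1 D.2 k hk

theorem coord_zero (D : A1 K) : coord K 0 D = 0 := by
  rw [coord_apply, coeff_eq_zero D (by norm_num), mul_zero]

theorem coeff_apply (D E : A1 K) (j : ℕ) :
    PowerSeries.coeff (j + 1) (D.1 (E.1 PowerSeries.X)) =
      ∑ p ∈ Finset.HasAntidiagonal.antidiagonal j, PowerSeries.coeff (p.1 + 1) (D.1 PowerSeries.X) *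
        (PowerSeries.coeff (p.2 + 1) (E.1 PowerSeries.X) * ((p.2 : K) + 1)) := by
  rw [derivation_apply D.1 (E.1 PowerSeries.X), PowerSeries.coeff_mul,
    Finset.Nat.antidiagonal_succ, Finset.sum_cons, coeff_eq_zero D (by norm_num), zero_mul,
    zero_add, Finset.sum_map]
  simp [PowerSeries.coeff_derivative]

/-- With `k`, `l` for the shifted indices and `j = k + l`, the right side is `j! (l(l+1) - k(k+1)) =
j! (l - k)(j + 1)`. The match holds only for the difference, not for each binomial alone. -/
theorem factorial_identity (k l : ℕ) :
    ((k + 1 + (l + 1) + 1).factorial : K) * (((l + 1 : ℕ) : K) - ((k + 1 : ℕ) : K)) =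
      ((k + 2).factorial : K) * ((l + 2).factorial : K) *
        (((k + 1 + (l + 1)).choose (k + 2) : K) - ((k + 1 + (l + 1)).choose (l + 2) : K)) := by
  have h1 := Nat.add_choose_mul_factorial_mul_factorial l (k + 2)
  have h2 := Nat.add_choose_mul_factorial_mul_factorial k (l + 2)
  rw [show k + (l + 2) = k + 1 + (l + 1) by omega] at h2
  rw [show l + (k + 2) = k + 1 + (l + 1) by omega] at h1
  have h1' := congrArg (Nat.cast (R := K)) h1
  have h2' := congrArg (Nat.cast (R := K)) h2
  rw [Nat.factorial_succ (k + 1 + (l + 1))]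
  have h3 : ((l + 2).factorial : K) = (l + 2) * ((l + 1) * (l.factorial : K)) := by
    rw [Nat.factorial_succ, Nat.factorial_succ]; push_cast; ring
  have h4 : ((k + 2).factorial : K) = (k + 2) * ((k + 1) * (k.factorial : K)) := by
    rw [Nat.factorial_succ, Nat.factorial_succ]; push_cast; ring
  push_cast at h1' h2' ⊢
  calc _ = ((l : K) + 2) * (l + 1) * ((k + 1 + (l + 1)).factorial : K) -
        ((k : K) + 2) * (k + 1) * ((k + 1 + (l + 1)).factorial : K) := by ring
    _ = ((l : K) + 2) * (l + 1) * (((k + 1 + (l + 1)).choose (k + 2) : K) *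
          (l.factorial : K) * ((k + 2).factorial : K)) -
        ((k : K) + 2) * (k + 1) * (((k + 1 + (l + 1)).choose (l + 2) : K) *
          (k.factorial : K) * ((l + 2).factorial : K)) := by rw [h1', h2']
    _ = ((k + 2).factorial : K) * (((k + 1 + (l + 1)).choose (k + 2) : K)) *
          ((l + 2) * ((l + 1) * (l.factorial : K))) -
        ((l + 2).factorial : K) * (((k + 1 + (l + 1)).choose (l + 2) : K)) *
          ((k + 2) * ((k + 1) * (k.factorial : K))) := by ring
    _ = _ := by rw [← h3, ← h4]; ring

/-- The bracket has component `f g' - g f'`. Pairing the `(k, l)` term of one sum with the `(l, k)`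
term of the other leaves the factor `l - k`, to which `factorial_identity` applies. The form of the
result is the one needed to compare with `H.linearPart₂_Δδ`. -/
theorem coord_lie (D E : A1 K) (j : ℕ) : coord K j ⁅D, E⁆ =
    ∑ p ∈ Finset.HasAntidiagonal.antidiagonal j, (j.choose (p.1 + 1) : K) * (coord K p.1 D * coord K p.2 E) -
    ∑ p ∈ Finset.HasAntidiagonal.antidiagonal j, (j.choose (p.1 + 1) : K) * (coord K p.1 E * coord K p.2 D) := by
  have h1 : coord K j ⁅D, E⁆ = ((j + 1).factorial : K) *
      (PowerSeries.coeff (j + 1) (D.1 (E.1 PowerSeries.X)) -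
        PowerSeries.coeff (j + 1) (E.1 (D.1 PowerSeries.X))) := by
    rw [coord_apply, LieSubalgebra.coe_bracket, Derivation.commutator_apply, map_sub]
  rw [h1, coeff_apply, coeff_apply, ← Finset.Nat.sum_antidiagonal_swap (n := j)
    (f := fun p => PowerSeries.coeff (p.1 + 1) (E.1 PowerSeries.X) *
      (PowerSeries.coeff (p.2 + 1) (D.1 PowerSeries.X) * ((p.2 : K) + 1))),
    ← Finset.Nat.sum_antidiagonal_swap (n := j)
    (f := fun p => (j.choose (p.1 + 1) : K) * (coord K p.1 E * coord K p.2 D)),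
    ← Finset.sum_sub_distrib, ← Finset.sum_sub_distrib, Finset.mul_sum]
  refine Finset.sum_congr rfl ?_
  rintro ⟨k, l⟩ hp
  rw [Finset.HasAntidiagonal.mem_antidiagonal] at hp
  simp only at hp
  simp only [Prod.fst_swap, Prod.snd_swap]
  rcases k with _ | k
  · simp [coord_zero, coeff_eq_zero D (show 1 < 2 by norm_num)]
  rcases l with _ | l
  · simp [coord_zero, coeff_eq_zero E (show 1 < 2 by norm_num)]
  have h := factorial_identity (K := K) k l
  subst hp
  simp only [coord_apply]
  push_cast at h ⊢
  linear_combination PowerSeries.coeff (k + 1 + 1) (D.1 PowerSeries.X) *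
    PowerSeries.coeff (l + 1 + 1) (E.1 PowerSeries.X) * h

theorem coord_zField [CharZero K] (j : ℕ) (k : ℕ+) :
    coord K j (zField K k) = if j = k then 1 else 0 := by
  have h : (zField K k).1 PowerSeries.X =
      (((k : ℕ) + 1).factorial : K)⁻¹ • (PowerSeries.X : K⟦X⟧) ^ ((k : ℕ) + 1) := by
    simp only [zField]
    rw [Derivation.smul_apply, PowerSeries.derivative_X, smul_eq_mul, mul_one]
  rw [coord_apply, h, map_smul, PowerSeries.coeff_X_pow, smul_eq_mul]
  by_cases hjk : j = k
  · subst hjk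
    rw [if_pos rfl, if_pos rfl, mul_one, mul_inv_cancel₀]
    exact_mod_cast Nat.factorial_ne_zero _
  · rw [if_neg hjk, if_neg (by omega), mul_zero, mul_zero]

variable (K) in
/-- The linear form on `⨁ K δ_n` defined by a vector field. -/
def form : A1 K →ₗ[K] (ℕ+ →₀ K) →ₗ[K] K :=
  (Finsupp.linearCombination K fun k : ℕ+ => coord K k).flip

theorem form_single (D : A1 K) (k : ℕ+) : form K D (Finsupp.single k 1) = coord K k D := by
  simp [form]

theorem form_basisVec (D : A1 K) (k : ℕ) : form K D (H.basisVec K k) = coord K k D := by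
  rcases k with _ | k
  · rw [H.basisVec_zero, map_zero, coord_zero]
  · have := form_single D k.succPNat
    rw [← H.basisVec_coe] at this
    exact this

end A1

end ConnesMoscovici

namespace ConnesMoscovici

open Coalgebra

variable {K : Type*} [Field K]

/-! ## The action of the jets on `H_n` -/

namespace Hn

variable (n : ℕ)

theorem incl₂_comul (p : Hn K n) :
    HopfAux.incl₂ (Hn K n) (comul p) = comul (R := K) (p : H K) :=
  HopfAux.incl₂_subComul (Hn K n) (comul_mem K n) p

theorem counit_coe (p : Hn K n) : counit (R := K) p = counit (R := K) (p : H K) := rfl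

theorem mul_comm' (P Q : Hn K n) : P * Q = Q * P :=
  Subtype.ext (H.comm_of_mem_adjoin K (H.gens_comm K n) P.2 Q.2)

theorem adjoin_δ : Algebra.adjoin K
    (Set.range fun i : {k : ℕ+ // (k : ℕ) ≤ n} => δ K n i.1 i.2) = ⊤ := by
  refine Subalgebra.map_injective (f := (Hn K n).val) Subtype.val_injective ?_
  rw [AlgHom.map_adjoin, Algebra.map_top, Subalgebra.range_val]
  refine congrArg (Algebra.adjoin K) ?_
  ext a
  constructor
  · rintro ⟨_, ⟨i, rfl⟩, rfl⟩
    exact ⟨i.1, i.2, rfl⟩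
  · rintro ⟨k, hk, rfl⟩
    exact ⟨_, ⟨⟨k, hk⟩, rfl⟩, rfl⟩

/-- The linear form on `H_n` defined by a vector field. -/
def fieldForm : A1 K →ₗ[K] WithConv (Hn K n →ₗ[K] K) where
  toFun D := WithConv.toConv (A1.form K D ∘ₗ H.linearPart K ∘ₗ (Hn K n).val.toLinearMap)
  map_add' D E := by rw [map_add, LinearMap.add_comp]; rfl
  map_smul' c D := by rw [map_smul, LinearMap.smul_comp]; rfl

theorem fieldForm_apply (D : A1 K) (p : Hn K n) :
    (fieldForm n D).ofConv p = A1.form K D (H.linearPart K p) := rfl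

theorem fieldForm_δ (D : A1 K) (k : ℕ+) (hk : (k : ℕ) ≤ n) :
    (fieldForm n D).ofConv (δ K n k hk) = A1.coord K k D := by
  rw [fieldForm_apply, δ, H.linearPart_δ, A1.form_single]

theorem isCounitDerivation_fieldForm (D : A1 K) :
    IsCounitDerivation (fieldForm n D).ofConv := by
  intro a b
  rw [fieldForm_apply, Subalgebra.coe_mul, linearPart_mul a.2, map_add, map_smul, map_smul,
    smul_eq_mul, smul_eq_mul, mul_comm]
  rfl

theorem fieldForm_mul_apply (D E : A1 K) (p : Hn K n) :
    (fieldForm n D * fieldForm n E).ofConv p =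
      LinearMap.mul' K K (TensorProduct.map (A1.form K D) (A1.form K E)
        (H.linearPart₂ K (comul (R := K) (p : H K)))) := by
  have key : ∀ t : Hn K n ⊗[K] Hn K n,
      LinearMap.mul' K K (TensorProduct.map (fieldForm n D).ofConv (fieldForm n E).ofConv t) =
      LinearMap.mul' K K (TensorProduct.map (A1.form K D) (A1.form K E)
        (H.linearPart₂ K (HopfAux.incl₂ (Hn K n) t))) := by
    intro t
    induction t using TensorProduct.induction_on with
    | zero => simp
    | add t t' ht ht' => simp only [map_add, ht, ht']
    | tmul a b => rfl
  rw [LinearMap.convMul_apply, key, incl₂_comul]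

theorem fieldForm_mul_δ (D E : A1 K) (j : ℕ+) (hj : (j : ℕ) ≤ n) :
    (fieldForm n D * fieldForm n E).ofConv (δ K n j hj) =
      ∑ p ∈ Finset.HasAntidiagonal.antidiagonal (j : ℕ),
        ((j : ℕ).choose (p.1 + 1) : K) * (A1.coord K p.1 D * A1.coord K p.2 E) := by
  have h : comul (R := K) ((δ K n j hj : Hn K n) : H K) = H.Δδ K j := H.comulHom_δ K j
  rw [fieldForm_mul_apply, h, H.linearPart₂_Δδ]
  simp only [map_sum, map_smul, TensorProduct.map_tmul, LinearMap.mul'_apply, A1.form_basisVec,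
    smul_eq_mul]

/-- Both sides are derivations over the counit, so it suffices to evaluate at the `δ_j`, where the
coproduct and the bracket have the same structure constants. -/
theorem fieldForm_lie (D E : A1 K) :
    fieldForm n ⁅D, E⁆ = fieldForm n D * fieldForm n E - fieldForm n E * fieldForm n D := by
  refine WithConv.ext ((isCounitDerivation_fieldForm n _).ext_of_adjoin
    (IsCounitDerivation.convMul_sub (isCounitDerivation_fieldForm n D)
      (isCounitDerivation_fieldForm n E)) (adjoin_δ n) ?_)
  rintro _ ⟨i, rfl⟩
  rw [fieldForm_δ, WithConv.ofConv_sub, LinearMap.sub_apply, fieldForm_mul_δ, fieldForm_mul_δ,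
    A1.coord_lie]

theorem fieldForm_eq_zero (D : A1 K) (hD : D ∈ A1Ideal K n) : fieldForm n D = 0 := by
  have h0 : IsCounitDerivation (0 : Hn K n →ₗ[K] K) := fun a b => by simp
  refine WithConv.ext ((isCounitDerivation_fieldForm n _).ext_of_adjoin h0 (adjoin_δ n) ?_)
  rintro _ ⟨i, rfl⟩
  have h := PowerSeries.X_pow_dvd_iff.1 hD (i.1 + 1) (by have := i.2; omega)
  rw [fieldForm_δ, A1.coord_apply, h, mul_zero]
  rfl

/-- The Lie homomorphism from the jets to the convolution algebra of `H_n`. -/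
def jetForm : A1n K n →ₗ⁅K⁆ WithConv (Hn K n →ₗ[K] K) :=
  { (A1Ideal K n).toSubmodule.liftQ (fieldForm n) (fun D hD => fieldForm_eq_zero n D hD) with
    map_lie' := fun {x y} => by
      obtain ⟨D, rfl⟩ := LieSubmodule.Quotient.surjective_mk' (A1Ideal K n) x
      obtain ⟨E, rfl⟩ := LieSubmodule.Quotient.surjective_mk' (A1Ideal K n) y
      exact fieldForm_lie n D E }

theorem jetForm_mk (D : A1 K) :
    jetForm n (LieSubmodule.Quotient.mk (N := A1Ideal K n) D) = fieldForm n D := rfl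

theorem isCounitDerivation_jetForm (x : A1n K n) : IsCounitDerivation (jetForm n x).ofConv := by
  obtain ⟨D, rfl⟩ := LieSubmodule.Quotient.surjective_mk' (A1Ideal K n) x
  exact isCounitDerivation_fieldForm n D

theorem jetForm_Z_δ [CharZero K] (j k : ℕ+) (hj : (j : ℕ) ≤ n) :
    (jetForm n (Z K n k)).ofConv (δ K n j hj) = if j = k then 1 else 0 := by
  rw [Z, jetForm_mk, fieldForm_δ, A1.coord_zField]
  exact if_congr PNat.coe_inj rfl rfl

end Hn

/-! ### The jets `Z_k` and the dual system in `H_n` -/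

theorem Z_eq_zero (n : ℕ) (k : ℕ+) (hk : n < k) : Z K n k = 0 := by
  refine (LieSubmodule.Quotient.mk_eq_zero' (N := A1Ideal K n)).2 ?_
  change (PowerSeries.X : K⟦X⟧) ^ (n + 2) ∣ _
  simp only [zField]
  rw [Derivation.smul_apply, PowerSeries.derivative_X, smul_eq_mul, mul_one]
  exact dvd_smul_of_dvd _ (pow_dvd_pow _ (by omega))

theorem span_Z [CharZero K] (n : ℕ) : Submodule.span K
    (Set.range fun i : {k : ℕ+ // (k : ℕ) ≤ n} => Z K n i.1) = ⊤ := by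
  rw [eq_top_iff]
  intro x _
  obtain ⟨D, rfl⟩ := LieSubmodule.Quotient.surjective_mk' (A1Ideal K n) x
  -- The Taylor part of `D`: the coordinates `1, …, n` are dual to the `Z_k`, so `D - E` has no
  -- coefficient below `x^{n+2}`.
  let E : A1 K := ∑ i : Fin n, A1.coord K (i + 1) D • zField K i.val.succPNat
  have hE : ∀ j, j ≤ n → A1.coord K j (D - E) = 0 := by
    intro j hj
    rw [map_sub, map_sum]
    simp only [map_smul, A1.coord_zField, smul_eq_mul]
    rcases j with _ | j
    · simp [A1.coord_zero]
    · rw [Finset.sum_eq_single ⟨j, hj⟩]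
      · simp
      · intro i _ hi
        rw [if_neg, mul_zero]
        intro h
        exact hi (Fin.ext (Nat.succ.inj h).symm)
      · simp
  have h1 : D - E ∈ A1Ideal K n := by
    change (PowerSeries.X : K⟦X⟧) ^ (n + 2) ∣ _
    rw [PowerSeries.X_pow_dvd_iff]
    intro m hm
    rcases m with _ | m
    · exact A1.coeff_eq_zero _ (by norm_num)
    · have h := hE m (by omega)
      rw [A1.coord_apply] at h
      exact (mul_eq_zero.1 h).resolve_left (by exact_mod_cast Nat.factorial_ne_zero _)
  have h2 : LieSubmodule.Quotient.mk' (A1Ideal K n) D = LieSubmodule.Quotient.mk' (A1Ideal K n) E := by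
    rw [← sub_eq_zero, ← map_sub]
    exact (LieSubmodule.Quotient.mk_eq_zero (A1Ideal K n)).2 h1
  rw [h2, map_sum]
  refine Submodule.sum_mem _ fun i _ => ?_
  rw [map_smul]
  exact Submodule.smul_mem _ _ (Submodule.subset_span ⟨⟨i.val.succPNat, i.2⟩, rfl⟩)

namespace Hn

variable (n : ℕ)

theorem isDualSystem [CharZero K] : UEA.IsDualSystem (jetForm (K := K) n)
    (fun i : {k : ℕ+ // (k : ℕ) ≤ n} => δ K n i.1 i.2) (fun i => Z K n i.1) where
  isCounitDerivation := isCounitDerivation_jetForm n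
  apply_eq i j := by
    rw [jetForm_Z_δ]
    exact if_congr Subtype.coe_inj rfl rfl
  counit_eq i := H.counit_δ K i.1
  adjoin_eq := adjoin_δ n
  span_eq := span_Z n

theorem lie_Y_mem {a : H K} (ha : a ∈ Hn K n) : H.Y K * a - a * H.Y K ∈ Hn K n := by
  refine ad_mem (H.Y K) {a | ∃ k : ℕ+, (k : ℕ) ≤ n ∧ a = H.δ K k} (Hn K n) le_rfl ?_ ha
  rintro _ ⟨k, hk, rfl⟩
  rw [H.Y_δ]
  exact (Hn K n).smul_mem (δ K n k hk).2 _

/-- The bracket with `Y`, which multiplies by the weight. -/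
def adY : Hn K n →ₗ[K] Hn K n where
  toFun a := ⟨H.Y K * a - a * H.Y K, lie_Y_mem n a.2⟩
  map_add' a b := Subtype.ext (by simp [mul_add, add_mul]; abel)
  map_smul' c a := Subtype.ext (by simp [smul_sub])

theorem coe_adY (a : Hn K n) : (adY n a : H K) = H.Y K * a - a * H.Y K := rfl

/-- A bracket is a derivation, and because `Y` is primitive it is also a coderivation. `Y` is not in
`H_n`, so the coproducts are compared inside `H ⊗ H`. -/
theorem isWeightOperator : UEA.IsWeightOperator (adY (K := K) n)
    (fun i : {k : ℕ+ // (k : ℕ) ≤ n} => δ K n i.1 i.2) (fun i => i.1) where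
  map_mul a b := Subtype.ext (by
    simp only [coe_adY, Subalgebra.coe_mul, Subalgebra.coe_add]
    noncomm_ring)
  comul_map a := by
    apply HopfAux.incl₂_injective
    have key : ∀ t : Hn K n ⊗[K] Hn K n,
        HopfAux.incl₂ (Hn K n) ((adY n).rTensor (Hn K n) t + (adY n).lTensor (Hn K n) t) =
          H.ΔY K * HopfAux.incl₂ (Hn K n) t - HopfAux.incl₂ (Hn K n) t * H.ΔY K := by
      intro t
      induction t using TensorProduct.induction_on with
      | zero => simp
      | add t t' ht ht' =>
        simp only [map_add, mul_add, add_mul] at ht ht' ⊢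
        rw [add_add_add_comm, ht, ht']; abel
      | tmul a b =>
        simp only [HopfAux.incl₂, H.ΔY, map_add, LinearMap.rTensor_tmul, LinearMap.lTensor_tmul,
          Algebra.TensorProduct.map_tmul, Subalgebra.coe_val, coe_adY, add_mul, mul_add,
          Algebra.TensorProduct.tmul_mul_tmul, one_mul, mul_one, TensorProduct.sub_tmul,
          TensorProduct.tmul_sub]
        abel
    rw [key, incl₂_comul, incl₂_comul, coe_adY, map_sub, Bialgebra.comul_mul,
      Bialgebra.comul_mul, H.comul_Y]
    rfl
  counit_map a := by
    rw [counit_coe, coe_adY, map_sub, Bialgebra.counit_mul, Bialgebra.counit_mul, H.counit_Y]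
    simp
  map_gen i := Subtype.ext (by
    rw [coe_adY]
    exact H.Y_δ K i.1)

end Hn

/-! ## The two descriptions of the dual -/

/-- The weights in `weightSpace` elaborate to a monadic coercion of the whole list; this turns it
into a `map`. -/
theorem coe_list_eq_map (l : List ℕ+) : (do let a ← l; pure (a : ℕ)) = l.map PNat.val := by
  induction l with
  | nil => rfl
  | cons k l ih => exact congrArg (List.cons (k : ℕ)) ih

theorem word_mem_weightSpace (n : ℕ) (l : List {k : ℕ+ // (k : ℕ) ≤ n}) :
    UEA.word (fun i : {k : ℕ+ // (k : ℕ) ≤ n} => Z K n i.1) l ∈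
      weightSpace K n (l.map fun i => (i.1 : ℕ)).sum :=
  Submodule.subset_span ⟨l.map Subtype.val, by
    rw [coe_list_eq_map, List.map_map, List.map_map]; rfl,
    by simp only [UEA.word, List.map_map, Function.comp_def]⟩

/-- `weightSpace` allows letters `Z_k` with `k > n`. They vanish as jets, so only words over the
finite index set matter. -/
theorem prod_eq_zero_or_word (n : ℕ) (l : List ℕ+) :
    (l.map fun k => UniversalEnvelopingAlgebra.ι K (Z K n k)).prod = 0 ∨
      ∃ l' : List {k : ℕ+ // (k : ℕ) ≤ n}, l'.map Subtype.val = l ∧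
        (l.map fun k => UniversalEnvelopingAlgebra.ι K (Z K n k)).prod =
          UEA.word (fun i : {k : ℕ+ // (k : ℕ) ≤ n} => Z K n i.1) l' := by
  induction l with
  | nil => exact Or.inr ⟨[], rfl, rfl⟩
  | cons k l ih =>
    rw [List.map_cons, List.prod_cons]
    by_cases hk : (k : ℕ) ≤ n
    · rcases ih with h | ⟨l', rfl, h⟩
      · left; rw [h, mul_zero]
      · right
        exact ⟨⟨k, hk⟩ :: l', rfl, by rw [UEA.word_cons, h]⟩
    · left
      rw [Z_eq_zero n k (by omega), map_zero, zero_mul]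

theorem mem_gradedDual_iff (n : ℕ)
    (f : Module.Dual K (UniversalEnvelopingAlgebra K (A1n K n))) :
    f ∈ gradedDual K n ↔ ∃ M : ℕ, ∀ l : List {k : ℕ+ // (k : ℕ) ≤ n},
      M ≤ (l.map fun i => (i.1 : ℕ)).sum →
        f (UEA.word (fun i : {k : ℕ+ // (k : ℕ) ≤ n} => Z K n i.1) l) = 0 := by
  constructor
  · rintro ⟨M, hM⟩
    exact ⟨M, fun l hl => hM _ hl _ (word_mem_weightSpace n l)⟩
  · rintro ⟨M, hM⟩
    refine ⟨M, fun d hd a ha => ?_⟩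
    have hle : weightSpace K n d ≤ LinearMap.ker f := by
      rw [weightSpace, Submodule.span_le]
      rintro _ ⟨l, hl, rfl⟩
      rw [SetLike.mem_coe, LinearMap.mem_ker]
      rcases prod_eq_zero_or_word (K := K) n l with h | ⟨l', rfl, h⟩
      · rw [h, map_zero]
      · rw [h]
        refine hM l' ?_
        rw [coe_list_eq_map, List.map_map, List.map_map] at hl
        exact hl ▸ hd
    exact hle ha

theorem word_mem_pow (n : ℕ) (l : List {k : ℕ+ // (k : ℕ) ≤ n}) :
    UEA.word (fun i : {k : ℕ+ // (k : ℕ) ≤ n} => Z K n i.1) l ∈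
      (RingHom.ker (Bialgebra.counitAlgHom K
        (UniversalEnvelopingAlgebra K (A1n K n)))) ^ l.length := by
  induction l with
  | nil => rw [List.length_nil, Submodule.pow_zero, Ideal.one_eq_top]; exact Submodule.mem_top
  | cons i l ih =>
    rw [UEA.word_cons, List.length_cons, Ideal.IsTwoSided.pow_succ]
    exact Ideal.mul_mem_mul (UEA.counit_ι K _ _) ih

/-! ### Powers of the augmentation ideal and long words -/

/-- The span of the words of length at least `r`. -/
def longWords (K : Type*) [Field K] (n r : ℕ) :
    Submodule K (UniversalEnvelopingAlgebra K (A1n K n)) :=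
  Submodule.span K (UEA.word (fun i : {k : ℕ+ // (k : ℕ) ≤ n} => Z K n i.1) ''
    {l | r ≤ l.length})

theorem longWords_mul_mem (n : ℕ) {r s : ℕ} {a b : UniversalEnvelopingAlgebra K (A1n K n)}
    (ha : a ∈ longWords K n r) (hb : b ∈ longWords K n s) : a * b ∈ longWords K n (r + s) := by
  have h := Submodule.mul_mem_mul ha hb
  rw [longWords, longWords, Submodule.span_mul_span] at h
  refine Submodule.span_mono ?_ h
  rintro _ ⟨_, ⟨l, hl, rfl⟩, _, ⟨m, hm, rfl⟩, rfl⟩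
  refine ⟨l ++ m, ?_, UEA.word_append _ l m⟩
  simp only [Set.mem_ofPred_eq, List.length_append] at hl hm ⊢
  omega

theorem mem_longWords_zero [CharZero K] (n : ℕ) (a : UniversalEnvelopingAlgebra K (A1n K n)) :
    a ∈ longWords K n 0 := by
  have h := UEA.span_word (span_Z (K := K) n)
  simp [longWords, h]

theorem mem_longWords_one [CharZero K] (n : ℕ) {a : UniversalEnvelopingAlgebra K (A1n K n)}
    (ha : counit (R := K) a = 0) : a ∈ longWords K n 1 := by
  -- Subtracting the counit removes the empty word from an expansion in words and changes no other,
  -- since the counit kills nonempty words.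
  have key : ∀ a : UniversalEnvelopingAlgebra K (A1n K n),
      a - algebraMap K _ (counit (R := K) a) ∈ longWords K n 1 := by
    intro a
    have h : a ∈ Submodule.span K (Set.range (UEA.word (K := K)
        (fun i : {k : ℕ+ // (k : ℕ) ≤ n} => Z K n i.1))) :=
      UEA.span_word (span_Z (K := K) n) ▸ Submodule.mem_top
    induction h using Submodule.span_induction with
    | mem a ha =>
      obtain ⟨l, rfl⟩ := ha
      rcases l with _ | ⟨i, l⟩
      · simp
      · have h0 : counit (R := K) (UEA.word (K := K)
            (fun i : {k : ℕ+ // (k : ℕ) ≤ n} => Z K n i.1) (i :: l)) = 0 := by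
          rw [UEA.word_cons, Bialgebra.counit_mul, UEA.counit_ι K (A1n K n), zero_mul]
        rw [h0, map_zero, sub_zero]
        exact Submodule.subset_span ⟨i :: l, by simp, rfl⟩
    | zero => simp
    | add a b _ _ ha hb =>
      rw [map_add, map_add, add_sub_add_comm]
      exact Submodule.add_mem _ ha hb
    | smul c a _ ha =>
      have : c • a - algebraMap K _ (counit (R := K) (c • a)) =
          c • (a - algebraMap K (UniversalEnvelopingAlgebra K (A1n K n))
            (counit (R := K) a)) := by
        simp [Algebra.algebraMap_eq_smul_one, smul_sub, mul_smul]
      rw [this]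
      exact Submodule.smul_mem _ c ha
  simpa [ha] using key a

theorem mem_longWords_of_mem_pow [CharZero K] (n r : ℕ)
    {a : UniversalEnvelopingAlgebra K (A1n K n)}
    (ha : a ∈ (RingHom.ker (Bialgebra.counitAlgHom K
      (UniversalEnvelopingAlgebra K (A1n K n)))) ^ r) : a ∈ longWords K n r := by
  induction r generalizing a with
  | zero => exact mem_longWords_zero n a
  | succ r ih =>
    rw [Submodule.pow_succ] at ha
    refine Submodule.mul_induction_on ha (fun p hp q hq => ?_) (fun p q hp hq => ?_)
    · exact longWords_mul_mem n (ih hp) (mem_longWords_one n hq)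
    · exact Submodule.add_mem _ hp hq

theorem restrictedDual_eq_gradedDual [CharZero K] (n : ℕ) :
    restrictedDual K (A1n K n) = gradedDual K n := by
  ext f
  rw [mem_gradedDual_iff]
  constructor
  · rintro ⟨m, hm⟩
    -- Letters weigh at most `n`, so weight above `n * m` forces length above `m`. The strict bound
    -- also covers `n = 0`, where it excludes the empty word.
    refine ⟨n * m + 1, fun l hl => hm _ (Ideal.pow_le_pow_right ?_ (word_mem_pow n l))⟩
    have h1 : (l.map fun i => (i.1 : ℕ)).sum ≤ l.length * n := by
      have := List.sum_le_card_nsmul (l.map fun i => (i.1 : ℕ)) n (by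
        intro k hk
        obtain ⟨i, _, rfl⟩ := List.mem_map.1 hk
        exact i.2)
      simpa using this
    rw [mul_comm] at h1
    exact (Nat.lt_of_mul_lt_mul_left (Nat.lt_of_succ_le (hl.trans h1))).le
  · rintro ⟨M, hM⟩
    -- The ideal's `M`-th power lies in the span of words of length at least `M`, and letters weigh
    -- at least `1`.
    refine ⟨M, fun a ha => ?_⟩
    have hle : longWords K n M ≤ LinearMap.ker f := by
      rw [longWords, Submodule.span_le]
      rintro _ ⟨l, hl, rfl⟩
      refine hM l (le_trans hl ?_)
      have := List.length_le_sum_of_one_le (l.map fun i => (i.1 : ℕ)) (by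
        intro k hk
        obtain ⟨i, _, rfl⟩ := List.mem_map.1 hk
        exact i.1.pos)
      simpa using this
    exact hle (mem_longWords_of_mem_pow n M ha)

/-! ### The isomorphism onto the restricted dual -/

theorem exists_pairing_eq_iff_mem_gradedDual [CharZero K] (n : ℕ)
    (f : Module.Dual K (UniversalEnvelopingAlgebra K (A1n K n))) :
    (∃ P, UEA.pairing (Hn.jetForm n) P = f) ↔ f ∈ gradedDual K n := by
  have : Finite {k : ℕ+ // (k : ℕ) ≤ n} :=
    Finite.of_injective (fun i => (⟨i.1, Nat.lt_succ_of_le i.2⟩ : Fin (n + 1)))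
      fun i j hij => Subtype.ext (PNat.eq (Fin.mk.inj_iff.1 hij))
  rw [mem_gradedDual_iff]
  exact (Hn.isDualSystem n).exists_pairing_eq_iff (Hn.mul_comm' n) (Hn.isWeightOperator n)
    (fun i => i.1.pos) f

theorem pairing_jetForm_injective [CharZero K] (n : ℕ) :
    Function.Injective (UEA.pairing (Hn.jetForm (K := K) n)) :=
  (Hn.isDualSystem n).injective_of_comm (Hn.mul_comm' n)

/-- `H_n` is the restricted dual of the enveloping algebra of the jets. -/
def equivRestrictedDual [CharZero K] (n : ℕ) :
    Hn K n ≃ₗ[K] restrictedDual K (A1n K n) :=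
  LinearEquiv.ofBijective
    ((UEA.pairing (Hn.jetForm n)).codRestrict (restrictedDual K (A1n K n)) fun P => by
      rw [restrictedDual_eq_gradedDual]
      exact (exists_pairing_eq_iff_mem_gradedDual n _).1 ⟨P, rfl⟩)
    ⟨fun P Q hPQ => pairing_jetForm_injective n (congrArg Subtype.val hPQ), fun f => by
      have hf := (restrictedDual_eq_gradedDual (K := K) n).le f.2
      obtain ⟨P, hP⟩ := (exists_pairing_eq_iff_mem_gradedDual n _).2 hf
      exact ⟨P, Subtype.ext hP⟩⟩

end ConnesMoscovici

end

theorem proposition3 {K : Type*} [Field K] [CharZero K] (n : ℕ) :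
    (∀ P Q : ConnesMoscovici.Hn K n, P * Q = Q * P) ∧
      ConnesMoscovici.restrictedDual K (ConnesMoscovici.A1n K n) =
        ConnesMoscovici.gradedDual K n ∧
      ∃ e : ConnesMoscovici.Hn K n ≃ₗ[K]
          ConnesMoscovici.restrictedDual K (ConnesMoscovici.A1n K n),
        ConnesMoscovici.IsHopfPairing K
            ((ConnesMoscovici.restrictedDual K (ConnesMoscovici.A1n K n)).subtype ∘ₗ
              e.toLinearMap) ∧
          ∀ (j k : ℕ+) (hj : (j : ℕ) ≤ n), (k : ℕ) ≤ n →
            (e (ConnesMoscovici.Hn.δ K n j hj) :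
                Module.Dual K (UniversalEnvelopingAlgebra K (ConnesMoscovici.A1n K n)))
              (UniversalEnvelopingAlgebra.ι K (ConnesMoscovici.Z K n k)) =
                if j = k then 1 else 0 := by
  refine ⟨ConnesMoscovici.Hn.mul_comm' n, ConnesMoscovici.restrictedDual_eq_gradedDual n,
    ConnesMoscovici.equivRestrictedDual n,
    -- Composed with the inclusion of the restricted dual, the isomorphism is by definition the
    -- pairing.
    UEA.isHopfPairing_pairing _ (ConnesMoscovici.Hn.isCounitDerivation_jetForm n),
    fun j k hj _ => ?_⟩
  exact (UEA.pairing_ι _ _ _).trans (ConnesMoscovici.Hn.jetForm_Z_δ n j k hj)
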